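/- **Setting.** Let $\Omega_M=\{1,\dots,M\}$ be a set of hypotheses, $\mathcal A$ a finite set of actions, and for each $a\in\mathcal A$, $i\in\Omega_M$ let $q_i^a$ be a probability density on an observation space $\mathcal Z$ (with respect to a fixed $\sigma$-finite reference measure, written $dz$). The true hypothesis $\theta$ has prior $\rho\in\mathbb P(\Omega_M)=\{\rho\in[0,1]^M:\sum_i\rho_i=1\}$. At each time $t=0,1,\dots$ an action $A(t)$ is chosen as a (possibly randomized) function of the past actions and observations, and an observation $Z(t)$ is drawn from the density $q_\theta^{A(t)}$, conditionally independently of the past. Given a penalty $L$, the decision maker chooses the actions, a stopping time $\tau$ of the actions and observations before the current time, and a declaration $d(A(0),Z(0),\dots,A(\tau-1),Z(\tau-1))\in\Omega_M$. Let $$V^*(\rho)=\inf\ \big\{\mathbb E[\tau]+L\,P(d\ne\theta)\big\}$$ be the optimal expected total cost over all these choices. All logarithms are in base 2; $[x]^+=\max\{x,0\}$; $H(p)=\sum_i p_i\log(1/p_i)$ with $0\log\frac10=0$; $D(\cdot\|\cdot)$ is the Kullback–Leibler divergence. With $q^a_\rho=\sum_i\rho_iq^a_i$, and with $\Phi^a(\rho,z)$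 the posterior belief $\big(\rho_iq^a_i(z)/q^a_\rho(z)\big)_i$ (equal to $\rho$ if $q^a_\rho(z)=0$), put $$I_a(\rho)=H(\rho)-\int H(\Phi^a(\rho,z))\,q^a_\rho(z)\,dz,\qquad I_{\max}=\max_{a}\max_{\hat\rho\in\mathbb P(\Omega_M)}I_a(\hat\rho),$$ $$D_{\max}=\max_{i,j,a}D(q_i^a\|q_j^a),\qquad \alpha=\frac{M-1}{M-1+2^{L I_{\max}}},\qquad \mathbb P_L(\Omega_M)=\{\rho\in\mathbb P(\Omega_M):\min_j(1-\rho_j)L>1\}.$$ *Assumption 1.* For all $i\ne j$ there is an action $a$ with $D(q_i^a\|q_j^a)>0$. *Assumption 2.* $\max_{i,j}\max_a\sup_z\log\frac{q_i^a(z)}{q_j^a(z)}\le\xi_M$ for some $\xi_M<\infty$. **Theorem.** (i) Under Assumption 1, for all $L>1$ and $\rho\in\mathbb P_L(\Omega_M)$, $$V^*(\rho)\ge\Big[\frac{H(\rho)-H([\alpha,1-\alpha])-\alpha\log(M-1)}{I_{\max}}+\alpha L\Big]^+ .$$ (ii) Under Assumptions 1 and 2 there is a constant $K_2'$, independent of $\delta$,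 $L$ and $\rho$, such that for all $L>\max\{1,\log M/I_{\max}\}$, all $\delta\in(0,\tfrac12]$ and all $\rho\in\mathbb P_L(\Omega_M)$, $$V^*(\rho)\ge V_2(\rho):=\Big[\frac{H(\rho)-H([\delta,1-\delta])-\delta\log(M-1)}{I_{\max}}+\frac{\log\frac{1-L^{-1}}{L^{-1}}-\log\frac{1-\delta}{\delta}-\xi_M}{D_{\max}}\,\mathbf 1_{\{\max_i\rho_i\le1-\delta\}}-K_2'\Big]^+ .$$ (iii) Consider a sequence of such problems, one for each $M\ge2$, whose action sets and observation kernels grow with $M$: $\mathcal A_M\subseteq\mathcal A_{M'}$ for $M<M'$, with $q_i^a$ for $i\in\Omega_M$, $a\in\mathcal A_M$ the same in both problems. If each of them satisfies Assumptions 1 and 2 and $\sup_M\xi_M<\infty$, then $K_2'$ in (ii) can be chosen independent of $M$ as well. -/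

import Mathlib

open MeasureTheory ProbabilityTheory
open scoped ENNReal NNReal

universe u v

namespace ActiveTesting

noncomputable section

/-- Observation kernels: for every action `a` and hypothesis `i`, a probability density `q a i` on the
observation space `Z` with respect to a fixed σ-finite reference measure `ref` (the measure `dz`). -/
structure ObsModel (Θ A Z : Type*) [MeasurableSpace Z] where
  ref : Measure Z
  sigmaFinite_ref : SigmaFinite ref
  q : A → Θ → Z → ℝ≥0
  measurable_q : ∀ a i, Measurable (q a i)
  lintegral_q : ∀ a i, ∫⁻ z, (q a i z : ℝ≥0∞) ∂ref = 1

namespace ObsModel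

variable {Θ A Z : Type*} [MeasurableSpace Z]

/-- The law of one observation when action `a` is taken and hypothesis `i` is true. -/
def obs (P : ObsModel Θ A Z) (i : Θ) (a : A) : Measure Z :=
  P.ref.withDensity fun z => (P.q a i z : ℝ≥0∞)

instance isProbabilityMeasure_obs (P : ObsModel Θ A Z) (i : Θ) (a : A) :
    IsProbabilityMeasure (P.obs i a) :=
  ⟨by rw [obs, withDensity_apply _ MeasurableSet.univ, Measure.restrict_univ, P.lintegral_q]⟩

/-- `D(q_i^a ‖ q_j^a)` in bits (Mathlib's `klDiv` uses the natural logarithm). -/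
def D (P : ObsModel Θ A Z) (a : A) (i j : Θ) : ℝ≥0∞ :=
  InformationTheory.klDiv (P.obs i a) (P.obs j a) / ENNReal.ofReal (Real.log 2)

/-- Any two distinct hypotheses are separated by some action. -/
def Distinguishable (P : ObsModel Θ A Z) : Prop :=
  ∀ i j : Θ, i ≠ j → ∃ a : A, 0 < P.D a i j

end ObsModel

/-- `log₂ (x / y)` as an extended real number; `+∞` when only `y` vanishes, `-∞` when only `x` does. -/
def logRatio (x y : ℝ≥0) : EReal :=
  if y = 0 then (if x = 0 then 0 else ⊤)
  else if x = 0 then ⊥ else ((Real.logb 2 ((x : ℝ) / (y : ℝ)) : ℝ) : EReal)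

/-- All log-likelihood ratios are bounded by the (finite) number `ξ`. -/
def ObsModel.BoundedLLR {Θ A Z : Type*} [MeasurableSpace Z] (P : ObsModel Θ A Z) (ξ : ℝ) : Prop :=
  ∀ (i j : Θ) (a : A) (z : Z), logRatio (P.q a i z) (P.q a j z) ≤ (ξ : EReal)

/-- Keep the first `M` hypotheses and the actions in `S`. -/
def ObsModel.restrict {A Z : Type*} [MeasurableSpace Z] (P : ObsModel ℕ A Z) (M : ℕ) (S : Finset A) :
    ObsModel (Fin M) {a // a ∈ S} Z where
  ref := P.ref
  sigmaFinite_ref := P.sigmaFinite_ref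
  q := fun a i => P.q a.1 i.1
  measurable_q := fun a i => P.measurable_q a.1 i.1
  lintegral_q := fun a i => P.lintegral_q a.1 i.1

/-! ### Entropy, Bayes' rule, mutual information -/

/-- Shannon entropy in bits; `0 log (1/0) = 0` by Lean's conventions. -/
def entropy {n : ℕ} (p : Fin n → ℝ) : ℝ := ∑ i, p i * Real.logb 2 (1 / p i)

namespace ObsModel

variable {M : ℕ} {A Z : Type*} [MeasurableSpace Z]

/-- The mixture density `q^a_ρ`. -/
def mix (P : ObsModel (Fin M) A Z) (a : A) (ρ : Fin M → ℝ) (z : Z) : ℝ := ∑ i, ρ i * P.q a i z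

/-- Bayes' rule: the posterior belief `Φ^a(ρ, z)`. -/
def posterior (P : ObsModel (Fin M) A Z) (a : A) (ρ : Fin M → ℝ) (z : Z) : Fin M → ℝ :=
  if P.mix a ρ z = 0 then ρ else fun i => ρ i * P.q a i z / P.mix a ρ z

/-- The Markov operator `T^a` on functions of the belief. -/
def T (P : ObsModel (Fin M) A Z) (a : A) (g : (Fin M → ℝ) → ℝ) (ρ : Fin M → ℝ) : ℝ :=
  ∫ z, g (P.posterior a ρ z) * P.mix a ρ z ∂P.ref

/-- Mutual information between the hypothesis, distributed as `ρ`, and the observation under `a`. -/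
def mutualInfo (P : ObsModel (Fin M) A Z) (a : A) (ρ : Fin M → ℝ) : ℝ :=
  entropy ρ - P.T a entropy ρ

/-- `I_max`: the largest mutual information over actions and beliefs. -/
def Imax (P : ObsModel (Fin M) A Z) : ℝ :=
  ⨆ p : A × stdSimplex ℝ (Fin M), P.mutualInfo p.1 p.2.1

/-- `D_max`: the largest divergence between two kernels of the same action. -/
def Dmax (P : ObsModel (Fin M) A Z) : ℝ≥0∞ := ⨆ (i : Fin M) (j : Fin M) (a : A), P.D a i j

/-- `α(L, M) = (M - 1) / (M - 1 + 2 ^ (L I_max))`. -/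
def alpha (P : ObsModel (Fin M) A Z) (L : ℝ) : ℝ :=
  ((M : ℝ) - 1) / ((M : ℝ) - 1 + (2 : ℝ) ^ (L * P.Imax))

end ObsModel

/-! ### Policies, their laws, and the optimal value function -/

/-- The record `(A(0), Z(0)), …, (A(n-1), Z(n-1))` of a trajectory before time `n`. -/
def history {X : Type*} (n : ℕ) (ω : ℕ → X) : Fin n → X := fun k => ω k

theorem measurable_history {X : Type*} [MeasurableSpace X] (n : ℕ) :
    Measurable (history (X := X) n) :=
  measurable_pi_lambda _ fun _ => measurable_pi_apply _

/-- The filtration whose `n`-th σ-algebra is generated by the record before time `n`. -/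
def historyFiltration (X : Type*) [MeasurableSpace X] :
    Filtration ℕ (MeasurableSpace.pi : MeasurableSpace (ℕ → X)) where
  seq n := MeasurableSpace.comap (history n) MeasurableSpace.pi
  mono' := by
    intro n m hnm
    have h : (history n : (ℕ → X) → Fin n → X) =
        (fun (g : Fin m → X) (k : Fin n) => g (Fin.castLE hnm k)) ∘ history m := rfl
    have hm : Measurable (fun (g : Fin m → X) (k : Fin n) => g (Fin.castLE hnm k)) :=
      measurable_pi_lambda _ fun _ => measurable_pi_apply _
    change MeasurableSpace.comap (history n) _ ≤ MeasurableSpace.comap (history m) _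
    rw [h, ← MeasurableSpace.comap_comp]
    exact MeasurableSpace.comap_mono hm.comap_le
  le' n := (measurable_history n).comap_le

/-- A policy: randomized choices of the actions given the past actions and observations, a stopping time
of the past actions and observations, and a declaration rule. -/
structure Policy (M : ℕ) (A Z : Type*) [MeasurableSpace A] [MeasurableSpace Z] where
  act : (n : ℕ) → Kernel (Fin n → A × Z) A
  isMarkovKernel_act : ∀ n, IsMarkovKernel (act n)
  τ : (ℕ → A × Z) → ℕ∞
  isStoppingTime_τ : IsStoppingTime (historyFiltration (A × Z)) τ
  declare : (n : ℕ) → (Fin n → A × Z) → Fin M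
  measurable_declare : ∀ n, Measurable (declare n)

attribute [instance] Policy.isMarkovKernel_act

section Cost

variable {M : ℕ} {A Z : Type*} [Finite A] [MeasurableSpace A] [MeasurableSingletonClass A]
  [MeasurableSpace Z]

/-- The observation kernel of hypothesis `i`, as a Markov kernel from actions to observations. -/
def ObsModel.obsKernel (P : ObsModel (Fin M) A Z) (i : Fin M) : Kernel A Z :=
  Kernel.ofFunOfCountable (P.obs i)

instance (P : ObsModel (Fin M) A Z) (i : Fin M) : IsMarkovKernel (P.obsKernel i) :=
  ⟨fun a => P.isProbabilityMeasure_obs i a⟩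

/-- Law of `(A(n), Z(n))` under hypothesis `i`, given the record before time `n`: the action is drawn
by the policy, and then the observation by the kernel of hypothesis `i` and that action. -/
def stepKernel (P : ObsModel (Fin M) A Z) (π : Policy M A Z) (i : Fin M) (n : ℕ) :
    Kernel (Fin n → A × Z) (A × Z) :=
  π.act n ⊗ₖ Kernel.prodMkLeft (Fin n → A × Z) (P.obsKernel i)

instance (P : ObsModel (Fin M) A Z) (π : Policy M A Z) (i : Fin M) (n : ℕ) :
    IsMarkovKernel (stepKernel P π i n) := by
  unfold stepKernel; infer_instance

/-- Reindexing of records by `Fin (n + 1)` instead of `{0, …, n}`. -/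
def ofIic {X : Type*} (n : ℕ) (h : Finset.Iic n → X) : Fin (n + 1) → X :=
  fun k => h ⟨k, Finset.mem_Iic.2 (Nat.lt_succ_iff.1 k.2)⟩

theorem measurable_ofIic {X : Type*} [MeasurableSpace X] (n : ℕ) :
    Measurable (ofIic (X := X) n) :=
  measurable_pi_lambda _ fun _ => measurable_pi_apply _

/-- Law of the sequence `(A(0), Z(0)), (A(1), Z(1)), …` under hypothesis `i` and policy `π`. -/
def law (P : ObsModel (Fin M) A Z) (π : Policy M A Z) (i : Fin M) : Measure (ℕ → A × Z) :=
  Kernel.trajMeasure (X := fun _ => A × Z) (stepKernel P π i 0 Fin.elim0)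
    (fun n => (stepKernel P π i (n + 1)).comap (ofIic n) (measurable_ofIic n))

/-- Joint law of the true hypothesis `θ ∼ ρ` and the sequence of actions and observations. -/
def jointLaw (P : ObsModel (Fin M) A Z) (π : Policy M A Z) (ρ : Fin M → ℝ) :
    Measure (Fin M × (ℕ → A × Z)) :=
  ∑ i, ENNReal.ofReal (ρ i) • (law P π i).map (fun ω => (i, ω))

/-- The event that the policy stops and declares a wrong hypothesis. -/
def Policy.wrong (π : Policy M A Z) : Set (Fin M × (ℕ → A × Z)) :=
  {x | ∃ n : ℕ, π.τ x.2 = n ∧ π.declare n (history n x.2) ≠ x.1}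

/-- Expected total cost `E[τ] + L Pe` of a policy under the prior `ρ`. -/
def cost (P : ObsModel (Fin M) A Z) (L : ℝ) (ρ : Fin M → ℝ) (π : Policy M A Z) : ℝ≥0∞ :=
  (∫⁻ x, (π.τ x.2 : ℝ≥0∞) ∂jointLaw P π ρ) + ENNReal.ofReal L * jointLaw P π ρ π.wrong

/-- The optimal value function `V*`. -/
def Vstar (P : ObsModel (Fin M) A Z) (L : ℝ) (ρ : Fin M → ℝ) : ℝ≥0∞ :=
  ⨅ π : Policy M A Z, cost P L ρ π

end Cost

/-- The region of interest `P_L(Ω_M)`: beliefs with `min_j (1 - ρ_j) L > 1`. -/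
def region (M : ℕ) (L : ℝ) : Set (Fin M → ℝ) :=
  {ρ | ρ ∈ stdSimplex ℝ (Fin M) ∧ ∀ j, 1 < (1 - ρ j) * L}

open Classical in
/-- The lower bound `V₂`, with log-likelihood bound `ξ` and additive constant `K`. The condition of the
indicator is `max_i ρ_i ≤ 1 - δ`. -/
def V2 {M : ℕ} {A Z : Type*} [MeasurableSpace Z] (P : ObsModel (Fin M) A Z)
    (ξ K L δ : ℝ) (ρ : Fin M → ℝ) : ℝ :=
  max 0
    ((entropy ρ - entropy ![δ, 1 - δ] - δ * Real.logb 2 ((M : ℝ) - 1)) / P.Imax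
      + (Real.logb 2 ((1 - L⁻¹) / L⁻¹) - Real.logb 2 ((1 - δ) / δ) - ξ) / P.Dmax.toReal
        * (if ∀ i, ρ i ≤ 1 - δ then 1 else 0)
      - K)

end

end ActiveTesting

open ActiveTesting

/-!
The value function dominates every measurable function `W ≥ 0` of the belief that satisfies the two Bellman
inequalities: `W ρ ≤ L (1 - ρ j)` for every declaration `j`, and `W ρ ≤ 1 + E[W (next belief)]` for every
action (`le_Vstar_of_bellman`). To see this, follow a policy for `n` steps. The iterated posterior is the
conditional law of the true hypothesis given the record (`bayesExp_eq_belief`), so the error probability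
on stopping is one minus the belief in the declared hypothesis. What is left after `n` steps is at most
`L P(τ ≥ n)`, which tends to `0` when the expected stopping time is finite. It remains to find good
functions `W`.

*The entropy bound.* The entropy of the belief falls by at most `I_max` per observation on average, by the
definition of `I_max`. On stopping, Gibbs' inequality bounds it by any tangent of Fano's function
`ε ↦ h(ε) + ε log (M - 1)` (`entropy_le_tangent`), and `α` is the point where the slope of that function
is `L I_max`. So the affine function of the entropy in the statement satisfies both inequalities. That
`I_max > 0` follows from the uniform prior being the only one of maximal entropy.

*The combined bound.* For a single hypothesis `J` with belief `p`, tested against its complement, the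
expected log-odds in favour of the truth are `φ(p) = (2 p - 1) log (p / (1 - p))`. Their mean increment
is a mean of divergences between `q J` and a mixture of the other densities, hence at most `D_max` by
convexity (`ObsModel.BoundedLLR.T_expectedLogOdds_le`), so the positive part of
`(log (L - 1) - φ(ρ J)) / D_max - K` satisfies both inequalities for every `J`. Unlike the log-odds of
`J` themselves, `φ` is also large when `J` has been ruled out, and it is nonnegative, whatever the number
of hypotheses. As long as no belief exceeds `1 - δ`, the entropy term is added to the value that the
log-odds term will at least have when the level `1 - δ` is passed; the overshoot is at most `ξ`
(`ObsModel.BoundedLLR.overshoot_le`). This sum lies below the cost of stopping because `log M < L I_max`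
(`combined_le_penalty`). The maximum of these functions is `combinedBound`.

*The constant.* The inequality for stopping only needs `log u ≤ c u + const` with `c` below both `I_max` and
`D_max`, so `K` depends on such a `c` alone (`additiveConst`). Both quantities are nondecreasing along a
growing sequence of problems, since a belief on fewer hypotheses may be extended by zero
(`Imax_restrict_mono`, `Dmax_restrict_mono`). Hence their values for two hypotheses give one constant for
the whole sequence.
-/

namespace ActiveTesting

/-! ### Bayes' rule on the simplex of beliefs -/

section Bayes

variable {M : ℕ} {A : Type u} {Z : Type v} [MeasurableSpace Z]

theorem ObsModel.mix_nonneg (P : ObsModel (Fin M) A Z) (a : A) {ρ : Fin M → ℝ}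
    (hρ : ρ ∈ stdSimplex ℝ (Fin M)) (z : Z) : 0 ≤ P.mix a ρ z :=
  Finset.sum_nonneg fun i _ => mul_nonneg (hρ.1 i) (P.q a i z).coe_nonneg

theorem ObsModel.ofReal_mix (P : ObsModel (Fin M) A Z) (a : A) {ρ : Fin M → ℝ}
    (hρ : ρ ∈ stdSimplex ℝ (Fin M)) (z : Z) :
    ENNReal.ofReal (P.mix a ρ z) = ∑ i, ENNReal.ofReal (ρ i) * (P.q a i z : ℝ≥0∞) := by
  unfold ObsModel.mix
  rw [ENNReal.ofReal_sum_of_nonneg fun i _ => mul_nonneg (hρ.1 i) (P.q a i z).coe_nonneg]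
  refine Finset.sum_congr rfl fun i _ => ?_
  rw [ENNReal.ofReal_mul (hρ.1 i), ENNReal.ofReal_coe_nnreal]

/-- Bayes' rule with the denominator cleared; it also holds where the mixture density vanishes. -/
theorem ObsModel.posterior_mul_mix (P : ObsModel (Fin M) A Z) (a : A) {ρ : Fin M → ℝ}
    (hρ : ρ ∈ stdSimplex ℝ (Fin M)) (z : Z) (j : Fin M) :
    P.posterior a ρ z j * P.mix a ρ z = ρ j * P.q a j z := by
  unfold ObsModel.posterior
  split_ifs with h
  · have h' := (Finset.sum_eq_zero_iff_of_nonneg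
      (fun i _ => mul_nonneg (hρ.1 i) (P.q a i z).coe_nonneg)).1 h j (Finset.mem_univ j)
    rw [h, mul_zero]
    exact h'.symm
  · field_simp

theorem ObsModel.posterior_mem (P : ObsModel (Fin M) A Z) (a : A) {ρ : Fin M → ℝ}
    (hρ : ρ ∈ stdSimplex ℝ (Fin M)) (z : Z) : P.posterior a ρ z ∈ stdSimplex ℝ (Fin M) := by
  unfold ObsModel.posterior
  split_ifs with h
  · exact hρ
  · refine ⟨fun i =>
      div_nonneg (mul_nonneg (hρ.1 i) (P.q a i z).coe_nonneg) (P.mix_nonneg a hρ z), ?_⟩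
    rw [← Finset.sum_div]
    exact div_self h

@[fun_prop]
theorem ObsModel.measurable_qReal (P : ObsModel (Fin M) A Z) (a : A) (i : Fin M) :
    Measurable fun z => (P.q a i z : ℝ) :=
  (P.measurable_q a i).coe_nnreal_real

@[fun_prop]
theorem ObsModel.measurable_qENNReal (P : ObsModel (Fin M) A Z) (a : A) (i : Fin M) :
    Measurable fun z => (P.q a i z : ℝ≥0∞) :=
  (P.measurable_q a i).coe_nnreal_ennreal

theorem ObsModel.measurable_mix_prod (P : ObsModel (Fin M) A Z) (a : A) :
    Measurable fun x : (Fin M → ℝ) × Z => P.mix a x.1 x.2 := by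
  unfold ObsModel.mix
  refine Finset.measurable_sum _ fun i _ => ?_
  exact ((measurable_pi_apply i).comp measurable_fst).mul
    ((P.measurable_qReal a i).comp measurable_snd)

theorem ObsModel.measurable_posterior_prod (P : ObsModel (Fin M) A Z) (a : A) :
    Measurable fun x : (Fin M → ℝ) × Z => P.posterior a x.1 x.2 := by
  have hm := P.measurable_mix_prod a
  unfold ObsModel.posterior
  refine Measurable.ite (hm (measurableSet_singleton 0)) measurable_fst ?_
  refine measurable_pi_lambda _ fun i => ?_
  exact (((measurable_pi_apply i).comp measurable_fst).mul
    ((P.measurable_qReal a i).comp measurable_snd)).div hm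

theorem ObsModel.measurable_mix (P : ObsModel (Fin M) A Z) (a : A) (ρ : Fin M → ℝ) :
    Measurable fun z => P.mix a ρ z :=
  (P.measurable_mix_prod a).comp (measurable_const.prodMk measurable_id)

theorem ObsModel.measurable_posterior (P : ObsModel (Fin M) A Z) (a : A) (ρ : Fin M → ℝ) :
    Measurable fun z => P.posterior a ρ z :=
  (P.measurable_posterior_prod a).comp (measurable_const.prodMk measurable_id)

end Bayes

/-! ### The law of the trajectory, one step at a time -/

section Trajectory

theorem history_succ {X : Type*} (n : ℕ) (ω : ℕ → X) :
    history (n + 1) ω = Fin.snoc (α := fun _ => X) (history n ω) (ω n) := by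
  ext k
  refine Fin.lastCases ?_ (fun k => ?_) k
  · simp [history]
  · simp [history]

theorem measurable_snoc {X : Type*} [MeasurableSpace X] (n : ℕ) :
    Measurable fun p : (Fin n → X) × X => (Fin.snoc (α := fun _ => X) p.1 p.2 : Fin (n + 1) → X) := by
  refine measurable_pi_lambda _ fun k => ?_
  refine Fin.lastCases ?_ (fun k => ?_) k
  · simpa using measurable_snd
  · simpa using! (measurable_pi_apply k).comp (measurable_fst (α := Fin n → X) (β := X))

theorem map_frestrictLe_zero_trajMeasure {X : Type*} [MeasurableSpace X]
    (μ₀ : Measure X) [IsProbabilityMeasure μ₀]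
    (κ : (n : ℕ) → Kernel (Finset.Iic n → X) X) [∀ n, IsMarkovKernel (κ n)] :
    (Kernel.trajMeasure (X := fun _ => X) μ₀ κ).map (fun ω => ω 0) = μ₀ := by
  have h0 : (fun ω : ℕ → X => ω 0) =
      (fun x : Finset.Iic 0 → X => x ⟨0, by simp⟩) ∘ Preorder.frestrictLe (π := fun _ => X) 0 := rfl
  rw [h0, ← Measure.map_map (measurable_pi_apply _) (by fun_prop), Kernel.trajMeasure,
    Measure.map_comp _ _ (by fun_prop), Kernel.traj_map_frestrictLe, Kernel.partialTraj_self,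
    Measure.id_comp, Measure.map_map (measurable_pi_apply _) (by fun_prop)]
  exact Measure.map_id

variable {M : ℕ} {A : Type u} {Z : Type v} [Finite A] [MeasurableSpace A]
  [MeasurableSingletonClass A] [MeasurableSpace Z]

instance (P : ObsModel (Fin M) A Z) (π : Policy M A Z) (i : Fin M) :
    IsProbabilityMeasure (law P π i) := by
  unfold law; infer_instance

theorem lintegral_stepKernel (P : ObsModel (Fin M) A Z) (π : Policy M A Z) (i : Fin M) (n : ℕ)
    (h : Fin n → A × Z) {f : A × Z → ℝ≥0∞} (hf : Measurable f) :
    ∫⁻ x, f x ∂stepKernel P π i n h =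
      ∫⁻ a, ∫⁻ z, f (a, z) * P.q a i z ∂P.ref ∂π.act n h := by
  rw [stepKernel, Kernel.lintegral_compProd _ _ _ hf]
  refine lintegral_congr fun a => ?_
  rw [Kernel.prodMkLeft_apply]
  change ∫⁻ z, f (a, z) ∂P.obs i a = _
  rw [ObsModel.obs, lintegral_withDensity_eq_lintegral_mul _ (P.measurable_qENNReal a i)
    (by fun_prop)]
  exact lintegral_congr fun z => mul_comm _ _

theorem lintegral_history_succ_stepKernel (P : ObsModel (Fin M) A Z) (π : Policy M A Z) (i : Fin M)
    (n : ℕ) {g : (Fin (n + 1) → A × Z) → ℝ≥0∞} (hg : Measurable g) :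
    ∫⁻ ω, g (history (n + 1) ω) ∂law P π i =
      ∫⁻ ω, ∫⁻ x, g (Fin.snoc (α := fun _ => A × Z) (history n ω) x)
        ∂stepKernel P π i n (history n ω) ∂law P π i := by
  have hgs := hg.comp (measurable_snoc (X := A × Z) n)
  cases n with
  | zero =>
    have h0 : ∀ ω : ℕ → A × Z, history 0 ω = Fin.elim0 := fun ω => Subsingleton.elim _ _
    simp_rw [history_succ, h0]
    rw [lintegral_const, measure_univ, mul_one]
    have h1 := map_frestrictLe_zero_trajMeasure (stepKernel P π i 0 Fin.elim0)
      (fun n => (stepKernel P π i (n + 1)).comap (ofIic n) (measurable_ofIic n))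
    conv_rhs => rw [← h1]
    have hg0 : Measurable fun x : A × Z => g (Fin.snoc (α := fun _ => A × Z) Fin.elim0 x) :=
      hgs.comp (measurable_const.prodMk measurable_id)
    rw [lintegral_map hg0 (measurable_pi_apply 0)]
    rfl
  | succ m =>
    have h1 := Kernel.map_frestrictLe_trajMeasure_compProd_eq_map_trajMeasure
      (X := fun _ => A × Z) (μ₀ := stepKernel P π i 0 Fin.elim0)
      (κ := fun n => (stepKernel P π i (n + 1)).comap (ofIic n) (measurable_ofIic n)) (a := m)
    have hG : Measurable fun p : (Finset.Iic m → A × Z) × (A × Z) =>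
        g (Fin.snoc (α := fun _ => A × Z) (ofIic m p.1) p.2) :=
      hgs.comp (((measurable_ofIic m).comp measurable_fst).prodMk measurable_snd)
    have h2 := congrArg (fun μ => ∫⁻ p, g (Fin.snoc (α := fun _ => A × Z) (ofIic m p.1) p.2) ∂μ) h1
    rw [Measure.lintegral_compProd hG, lintegral_map (by
        exact Measurable.lintegral_kernel_prod_right' hG) (by fun_prop),
      lintegral_map hG (by fun_prop)] at h2
    simp_rw [history_succ (m + 1)]
    exact h2.symm

/-- The law of the record up to time `n + 1` in terms of the law of the record up to time `n`: the
action is drawn by the policy and the observation from the density of the true hypothesis. -/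
theorem lintegral_history_succ (P : ObsModel (Fin M) A Z) (π : Policy M A Z) (i : Fin M)
    (n : ℕ) {g : (Fin (n + 1) → A × Z) → ℝ≥0∞} (hg : Measurable g) :
    ∫⁻ ω, g (history (n + 1) ω) ∂law P π i =
      ∫⁻ ω, ∫⁻ a, ∫⁻ z, g (Fin.snoc (α := fun _ => A × Z) (history n ω) (a, z)) * P.q a i z
        ∂P.ref ∂π.act n (history n ω) ∂law P π i := by
  rw [lintegral_history_succ_stepKernel P π i n hg]
  refine lintegral_congr fun ω => lintegral_stepKernel P π i n _ ?_
  exact (hg.comp (measurable_snoc (X := A × Z) n)).comp (measurable_const.prodMk measurable_id)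

end Trajectory

/-! ### Posterior beliefs along a trajectory -/

section Belief

variable {M : ℕ} {A : Type u} {Z : Type v} [MeasurableSpace Z]

/-- The posterior belief after the record `h`, obtained by iterating Bayes' rule from the prior `ρ`. -/
noncomputable def ObsModel.belief (P : ObsModel (Fin M) A Z) (ρ : Fin M → ℝ) :
    (n : ℕ) → (Fin n → A × Z) → Fin M → ℝ
  | 0, _ => ρ
  | n + 1, h =>
    P.posterior (h (Fin.last n)).1 (P.belief ρ n fun k => h k.castSucc) (h (Fin.last n)).2

theorem ObsModel.belief_snoc (P : ObsModel (Fin M) A Z) (ρ : Fin M → ℝ) (n : ℕ)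
    (h : Fin n → A × Z) (x : A × Z) :
    P.belief ρ (n + 1) (Fin.snoc (α := fun _ => A × Z) h x) =
      P.posterior x.1 (P.belief ρ n h) x.2 := by
  simp [ObsModel.belief]

theorem ObsModel.belief_mem (P : ObsModel (Fin M) A Z) {ρ : Fin M → ℝ}
    (hρ : ρ ∈ stdSimplex ℝ (Fin M)) (n : ℕ) (h : Fin n → A × Z) :
    P.belief ρ n h ∈ stdSimplex ℝ (Fin M) := by
  induction n with
  | zero => exact hρ
  | succ n ih => exact P.posterior_mem _ (ih _) _

theorem measurable_lintegral_act [MeasurableSpace A] (P : ObsModel (Fin M) A Z)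
    (π : Policy M A Z) (n : ℕ)
    {F : (Fin n → A × Z) → A → Z → ℝ≥0∞}
    (hF : Measurable fun x : ((Fin n → A × Z) × A) × Z => F x.1.1 x.1.2 x.2) :
    Measurable fun h => ∫⁻ a, ∫⁻ z, F h a z ∂P.ref ∂π.act n h := by
  have := P.sigmaFinite_ref
  have h1 : Measurable fun x : (Fin n → A × Z) × A => ∫⁻ z, F x.1 x.2 z ∂P.ref :=
    Measurable.lintegral_prod_right' hF
  exact Measurable.lintegral_kernel_prod_right' h1

theorem measurable_snoc_assoc {X Y : Type*} [MeasurableSpace X] [MeasurableSpace Y] (n : ℕ)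
    {g : (Fin (n + 1) → X × Y) → ℝ≥0∞} (hg : Measurable g) :
    Measurable fun x : ((Fin n → X × Y) × X) × Y =>
      g (Fin.snoc (α := fun _ => X × Y) x.1.1 (x.1.2, x.2)) :=
  (hg.comp (measurable_snoc (X := X × Y) n)).comp
    (measurable_fst.fst.prodMk (measurable_fst.snd.prodMk measurable_snd))

theorem measurable_snoc_mul_q [MeasurableSpace A] (P : ObsModel (Fin M) A Z) (n : ℕ)
    {g : (Fin (n + 1) → A × Z) → ℝ≥0∞} (hg : Measurable g) (i : Fin M) (h : Fin n → A × Z) (a : A) :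
    Measurable fun z => g (Fin.snoc (α := fun _ => A × Z) h (a, z)) * P.q a i z :=
  ((measurable_snoc_assoc n hg).comp
    (measurable_const.prodMk measurable_id : Measurable fun z : Z => ((h, a), z))).mul
      (P.measurable_qENNReal a i)

variable [Finite A] [MeasurableSpace A] [MeasurableSingletonClass A]

theorem ObsModel.measurable_belief (P : ObsModel (Fin M) A Z) (ρ : Fin M → ℝ) (n : ℕ) :
    Measurable (P.belief ρ n) := by
  induction n with
  | zero => exact measurable_const
  | succ n ih =>
    have h1 : Measurable fun y : A × ((Fin M → ℝ) × Z) => P.posterior y.1 y.2.1 y.2.2 :=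
      measurable_from_prod_countable_right fun a => P.measurable_posterior_prod a
    have h2 : Measurable fun h : Fin (n + 1) → A × Z =>
        ((h (Fin.last n)).1, ((P.belief ρ n fun k => h k.castSucc), (h (Fin.last n)).2)) := by
      refine Measurable.prodMk (by fun_prop) (Measurable.prodMk (ih.comp ?_) (by fun_prop))
      exact measurable_pi_lambda _ fun k => measurable_pi_apply _
    exact h1.comp h2

theorem measurable_qProd (P : ObsModel (Fin M) A Z) (i : Fin M) :
    Measurable fun y : A × Z => (P.q y.1 i y.2 : ℝ≥0∞) :=
  measurable_from_prod_countable_right fun a => P.measurable_qENNReal a i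

/-- Expectation, under the prior `ρ`, of a functional of the true hypothesis and of the record before
time `n`. -/
noncomputable def bayesExp (P : ObsModel (Fin M) A Z) (π : Policy M A Z) (ρ : Fin M → ℝ) (n : ℕ)
    (G : Fin M → (Fin n → A × Z) → ℝ≥0∞) : ℝ≥0∞ :=
  ∑ i, ENNReal.ofReal (ρ i) * ∫⁻ ω, G i (history n ω) ∂law P π i

theorem bayesExp_mono (P : ObsModel (Fin M) A Z) (π : Policy M A Z) (ρ : Fin M → ℝ) (n : ℕ)
    {G G' : Fin M → (Fin n → A × Z) → ℝ≥0∞} (h : ∀ i x, G i x ≤ G' i x) :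
    bayesExp P π ρ n G ≤ bayesExp P π ρ n G' := by
  unfold bayesExp
  gcongr
  exact h _ _

theorem bayesExp_add (P : ObsModel (Fin M) A Z) (π : Policy M A Z) (ρ : Fin M → ℝ) (n : ℕ)
    {G : Fin M → (Fin n → A × Z) → ℝ≥0∞} (hG : ∀ i, Measurable (G i))
    (G' : Fin M → (Fin n → A × Z) → ℝ≥0∞) :
    bayesExp P π ρ n (fun i x => G i x + G' i x) =
      bayesExp P π ρ n G + bayesExp P π ρ n G' := by
  unfold bayesExp
  rw [← Finset.sum_add_distrib]
  refine Finset.sum_congr rfl fun i _ => ?_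
  rw [← mul_add, ← lintegral_add_left (f := fun ω => G i (history n ω))
    ((hG i).comp (measurable_history n))]

theorem bayesExp_const_mul (P : ObsModel (Fin M) A Z) (π : Policy M A Z) (ρ : Fin M → ℝ) (n : ℕ)
    {c : ℝ≥0∞} (hc : c ≠ ∞) (G : Fin M → (Fin n → A × Z) → ℝ≥0∞) :
    bayesExp P π ρ n (fun i x => c * G i x) = c * bayesExp P π ρ n G := by
  unfold bayesExp
  rw [Finset.mul_sum]
  refine Finset.sum_congr rfl fun i _ => ?_
  rw [lintegral_const_mul' _ _ hc, mul_left_comm]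

theorem bayesExp_succ (P : ObsModel (Fin M) A Z) (π : Policy M A Z) (ρ : Fin M → ℝ) (n : ℕ)
    {G : Fin M → (Fin (n + 1) → A × Z) → ℝ≥0∞} (hG : ∀ i, Measurable (G i)) :
    bayesExp P π ρ (n + 1) G = bayesExp P π ρ n fun i h =>
      ∫⁻ a, ∫⁻ z, G i (Fin.snoc (α := fun _ => A × Z) h (a, z)) * P.q a i z ∂P.ref ∂π.act n h := by
  unfold bayesExp
  refine Finset.sum_congr rfl fun i _ => ?_
  rw [lintegral_history_succ P π i n (hG i)]

theorem sum_mul_lintegral_act (P : ObsModel (Fin M) A Z) (π : Policy M A Z) (n : ℕ)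
    (h : Fin n → A × Z) (b : Fin M → ℝ) {F : Fin M → A → Z → ℝ≥0∞}
    (hF : ∀ i a, Measurable (F i a)) :
    ∑ i, ENNReal.ofReal (b i) * ∫⁻ a, ∫⁻ z, F i a z ∂P.ref ∂π.act n h =
      ∫⁻ a, ∫⁻ z, ∑ i, ENNReal.ofReal (b i) * F i a z ∂P.ref ∂π.act n h := by
  have h1 : ∀ a, ∫⁻ z, ∑ i, ENNReal.ofReal (b i) * F i a z ∂P.ref =
      ∑ i, ENNReal.ofReal (b i) * ∫⁻ z, F i a z ∂P.ref := fun a => by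
    rw [lintegral_finsetSum _ fun i _ => (hF i a).const_mul _]
    exact Finset.sum_congr rfl fun i _ => lintegral_const_mul _ (hF i a)
  simp_rw [h1]
  rw [lintegral_finsetSum _ fun i _ => Measurable.of_discrete]
  exact Finset.sum_congr rfl fun i _ => (lintegral_const_mul _ Measurable.of_discrete).symm

/-- The iterated posterior is the conditional law of the true hypothesis given the record: inside a
Bayesian expectation, the true hypothesis may be averaged out with the weights `belief`. -/
theorem bayesExp_eq_belief (P : ObsModel (Fin M) A Z) (π : Policy M A Z) {ρ : Fin M → ℝ}
    (hρ : ρ ∈ stdSimplex ℝ (Fin M)) (n : ℕ) {G : Fin M → (Fin n → A × Z) → ℝ≥0∞}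
    (hG : ∀ i, Measurable (G i)) :
    bayesExp P π ρ n G =
      bayesExp P π ρ n fun _ h => ∑ j, ENNReal.ofReal (P.belief ρ n h j) * G j h := by
  induction n with
  | zero =>
    have h0 : ∀ ω : ℕ → A × Z, history 0 ω = Fin.elim0 := fun ω => Subsingleton.elim _ _
    have h1 : ∑ i, ENNReal.ofReal (ρ i) = 1 := by
      rw [← ENNReal.ofReal_sum_of_nonneg fun i _ => hρ.1 i, hρ.2, ENNReal.ofReal_one]
    simp only [bayesExp, h0, lintegral_const, measure_univ, mul_one, ObsModel.belief]
    rw [← Finset.sum_mul, h1, one_mul]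
  | succ n ih =>
    have hb := P.measurable_belief ρ (n + 1)
    have hS : Measurable fun h => ∑ j, ENNReal.ofReal (P.belief ρ (n + 1) h j) * G j h :=
      Finset.measurable_sum _ fun j _ =>
        (((measurable_pi_apply j).comp hb).ennreal_ofReal).mul (hG j)
    have hq : ∀ i, Measurable fun x : ((Fin n → A × Z) × A) × Z => (P.q x.1.2 i x.2 : ℝ≥0∞) :=
      fun i => (measurable_qProd P i).comp (measurable_fst.snd.prodMk measurable_snd)
    rw [bayesExp_succ P π ρ n hG, bayesExp_succ P π ρ n fun _ => hS,
      ih fun i => measurable_lintegral_act P π n ((measurable_snoc_assoc n (hG i)).mul (hq i)),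
      ih fun i => measurable_lintegral_act P π n ((measurable_snoc_assoc n hS).mul (hq i))]
    congr 1
    funext _ h
    rw [sum_mul_lintegral_act P π n h _ fun i a => measurable_snoc_mul_q P n (hG i) i h a,
      sum_mul_lintegral_act P π n h _ fun i a => measurable_snoc_mul_q P n hS i h a]
    refine lintegral_congr fun a => lintegral_congr fun z => ?_
    have hbm := P.belief_mem hρ n h
    simp only [ObsModel.belief_snoc]
    simp_rw [mul_left_comm (ENNReal.ofReal (P.belief ρ n h _))]
    rw [← Finset.mul_sum, ← P.ofReal_mix a hbm, Finset.sum_mul]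
    refine Finset.sum_congr rfl fun j _ => ?_
    rw [mul_right_comm, ← ENNReal.ofReal_mul ((P.posterior_mem a hbm z).1 j),
      P.posterior_mul_mix a hbm, ENNReal.ofReal_mul (hbm.1 j), ENNReal.ofReal_coe_nnreal]
    ring

/-- One step of the Bayesian expectation of a functional of the record: the next observation is drawn
from the mixture density of the current belief. -/
theorem bayesExp_succ_mix (P : ObsModel (Fin M) A Z) (π : Policy M A Z) {ρ : Fin M → ℝ}
    (hρ : ρ ∈ stdSimplex ℝ (Fin M)) (n : ℕ) {g : (Fin (n + 1) → A × Z) → ℝ≥0∞}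
    (hg : Measurable g) :
    bayesExp P π ρ (n + 1) (fun _ => g) = bayesExp P π ρ n fun _ h =>
      ∫⁻ a, ∫⁻ z, g (Fin.snoc (α := fun _ => A × Z) h (a, z)) *
        ENNReal.ofReal (P.mix a (P.belief ρ n h) z) ∂P.ref ∂π.act n h := by
  have hq : ∀ i, Measurable fun x : ((Fin n → A × Z) × A) × Z => (P.q x.1.2 i x.2 : ℝ≥0∞) :=
    fun i => (measurable_qProd P i).comp (measurable_fst.snd.prodMk measurable_snd)
  rw [bayesExp_succ P π ρ n fun _ => hg, bayesExp_eq_belief P π hρ n fun i =>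
    measurable_lintegral_act P π n ((measurable_snoc_assoc n hg).mul (hq i))]
  congr 1
  funext _ h
  rw [sum_mul_lintegral_act P π n h _ fun i a => measurable_snoc_mul_q P n hg i h a]
  refine lintegral_congr fun a => lintegral_congr fun z => ?_
  rw [P.ofReal_mix a (P.belief_mem hρ n h), Finset.mul_sum]
  exact Finset.sum_congr rfl fun i _ => mul_left_comm _ _ _

end Belief

/-! ### Verification: functions satisfying the Bellman inequalities lie below the value function -/

section StoppingEvents

variable {M : ℕ} {A : Type u} {Z : Type v} [MeasurableSpace A] [MeasurableSpace Z]

theorem Policy.measurableSet_tau_eq (π : Policy M A Z) (n : ℕ) :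
    MeasurableSet {ω | π.τ ω = (n : ℕ∞)} :=
  (historyFiltration (A × Z)).le n _ (π.isStoppingTime_τ.measurableSet_eq n)

theorem Policy.measurableSet_lt_tau (π : Policy M A Z) (n : ℕ) :
    MeasurableSet {ω | (n : ℕ∞) < π.τ ω} :=
  (historyFiltration (A × Z)).le n _ (π.isStoppingTime_τ.measurableSet_gt n)

theorem Policy.measurableSet_wrongAt (π : Policy M A Z) (n : ℕ) (i : Fin M) :
    MeasurableSet {ω | π.τ ω = (n : ℕ∞) ∧ π.declare n (history n ω) ≠ i} :=
  (π.measurableSet_tau_eq n).inter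
    (((π.measurable_declare n).comp (measurable_history n)) (measurableSet_singleton i).compl)

end StoppingEvents

section Verification

variable {M : ℕ} {A : Type u} {Z : Type v} [Finite A] [MeasurableSpace A]
  [MeasurableSingletonClass A] [MeasurableSpace Z]

theorem lintegral_jointLaw (P : ObsModel (Fin M) A Z) (π : Policy M A Z) (ρ : Fin M → ℝ)
    (f : Fin M × (ℕ → A × Z) → ℝ≥0∞) :
    ∫⁻ x, f x ∂jointLaw P π ρ =
      ∑ i, ENNReal.ofReal (ρ i) * ∫⁻ ω, f (i, ω) ∂law P π i := by
  rw [jointLaw, lintegral_finsetSum_measure]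
  refine Finset.sum_congr rfl fun i _ => ?_
  rw [lintegral_smul_measure, (measurableEmbedding_prodMk_left i).lintegral_map, smul_eq_mul]

theorem jointLaw_apply (P : ObsModel (Fin M) A Z) (π : Policy M A Z) (ρ : Fin M → ℝ)
    (s : Set (Fin M × (ℕ → A × Z))) :
    jointLaw P π ρ s = ∑ i, ENNReal.ofReal (ρ i) * law P π i {ω | (i, ω) ∈ s} := by
  simp [jointLaw, (measurableEmbedding_prodMk_left _).map_apply, Set.preimage]

/-- The probability that the policy takes more than `n` observations. -/
noncomputable def survival (P : ObsModel (Fin M) A Z) (π : Policy M A Z) (ρ : Fin M → ℝ)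
    (n : ℕ) : ℝ≥0∞ :=
  ∑ i, ENNReal.ofReal (ρ i) * law P π i {ω | (n : ℕ∞) < π.τ ω}

/-- The probability that the policy stops at time `n` and declares a wrong hypothesis. -/
noncomputable def errorAt (P : ObsModel (Fin M) A Z) (π : Policy M A Z) (ρ : Fin M → ℝ)
    (n : ℕ) : ℝ≥0∞ :=
  ∑ i, ENNReal.ofReal (ρ i) *
    law P π i {ω | π.τ ω = (n : ℕ∞) ∧ π.declare n (history n ω) ≠ i}

/-- The expected value of `W` at the belief of time `n`, on the event that the policy has not stopped
before time `n`. -/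
noncomputable def remaining (P : ObsModel (Fin M) A Z) (π : Policy M A Z) (ρ : Fin M → ℝ)
    (W : (Fin M → ℝ) → ℝ≥0∞) (n : ℕ) : ℝ≥0∞ :=
  ∑ i, ENNReal.ofReal (ρ i) * ∫⁻ ω, {ω | (n : ℕ∞) ≤ π.τ ω}.indicator
    (fun ω => W (P.belief ρ n (history n ω))) ω ∂law P π i

theorem sum_survival_le (P : ObsModel (Fin M) A Z) (π : Policy M A Z) (ρ : Fin M → ℝ) (n : ℕ) :
    ∑ k ∈ Finset.range n, survival P π ρ k ≤ ∫⁻ x, (π.τ x.2 : ℝ≥0∞) ∂jointLaw P π ρ := by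
  rw [lintegral_jointLaw]
  simp only [survival]
  rw [Finset.sum_comm]
  refine Finset.sum_le_sum fun i _ => ?_
  rw [← Finset.mul_sum]
  gcongr
  have h1 : ∀ k : ℕ, law P π i {ω | (k : ℕ∞) < π.τ ω} =
      ∫⁻ ω, {ω | (k : ℕ∞) < π.τ ω}.indicator 1 ω ∂law P π i := fun k =>
    (lintegral_indicator_one (π.measurableSet_lt_tau k)).symm
  simp_rw [h1]
  rw [← lintegral_finsetSum _ fun k _ => measurable_one.indicator (π.measurableSet_lt_tau k)]
  refine lintegral_mono fun ω => ?_
  simp only [Set.indicator_apply, Set.mem_ofPred_eq, Pi.one_apply, Finset.sum_boole]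
  cases hτ : π.τ ω with
  | top => simp
  | coe t =>
    simp only [Nat.cast_lt]
    calc ((Finset.filter (fun k => k < t) (Finset.range n)).card : ℝ≥0∞)
        ≤ ((Finset.range t).card : ℝ≥0∞) := by
          refine Nat.cast_le.2 (Finset.card_le_card fun k hk => ?_)
          simpa using (Finset.mem_filter.1 hk).2
      _ = _ := by simp

theorem sum_errorAt_le (P : ObsModel (Fin M) A Z) (π : Policy M A Z) (ρ : Fin M → ℝ) (n : ℕ) :
    ∑ k ∈ Finset.range n, errorAt P π ρ k ≤ jointLaw P π ρ π.wrong := by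
  rw [jointLaw_apply]
  simp only [errorAt]
  rw [Finset.sum_comm]
  refine Finset.sum_le_sum fun i _ => ?_
  rw [← Finset.mul_sum]
  gcongr
  rw [← measure_biUnion_finset _ fun k _ => π.measurableSet_wrongAt k i]
  · refine measure_mono fun ω hω => ?_
    obtain ⟨k, _, hk⟩ := Set.mem_iUnion₂.1 hω
    exact ⟨k, hk⟩
  · intro k _ l _ hkl
    refine Set.disjoint_left.2 fun ω hk hl => hkl ?_
    exact_mod_cast hk.1.symm.trans hl.1

theorem remaining_zero (P : ObsModel (Fin M) A Z) (π : Policy M A Z) {ρ : Fin M → ℝ}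
    (hρ : ρ ∈ stdSimplex ℝ (Fin M)) (W : (Fin M → ℝ) → ℝ≥0∞) : remaining P π ρ W 0 = W ρ := by
  have h1 : ∑ i, ENNReal.ofReal (ρ i) = 1 := by
    rw [← ENNReal.ofReal_sum_of_nonneg fun i _ => hρ.1 i, hρ.2, ENNReal.ofReal_one]
  simp [remaining, ObsModel.belief, ← Finset.sum_mul, h1]

theorem remaining_succ_le (P : ObsModel (Fin M) A Z) (π : Policy M A Z) (ρ : Fin M → ℝ)
    {W : (Fin M → ℝ) → ℝ≥0∞} {B : ℝ≥0∞} (hρ : ρ ∈ stdSimplex ℝ (Fin M))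
    (hB : ∀ ρ ∈ stdSimplex ℝ (Fin M), W ρ ≤ B) (n : ℕ) :
    remaining P π ρ W (n + 1) ≤ B * survival P π ρ n := by
  unfold remaining survival
  rw [Finset.mul_sum]
  refine Finset.sum_le_sum fun i _ => ?_
  rw [mul_left_comm]
  gcongr
  rw [← lintegral_indicator_const (π.measurableSet_lt_tau n)]
  refine lintegral_mono fun ω => ?_
  have : {ω | ((n + 1 : ℕ) : ℕ∞) ≤ π.τ ω} = {ω | (n : ℕ∞) < π.τ ω} := by
    ext ω; simp [ENat.add_one_le_iff]
  rw [this]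
  exact Set.indicator_le_indicator (hB _ (P.belief_mem hρ _ _))

/-- One Bellman step along a policy: the policy stops at time `n`, and then the error probability is
one minus the belief in the declared hypothesis, or it pays for one more observation. -/
theorem remaining_le (P : ObsModel (Fin M) A Z) (π : Policy M A Z) {ρ : Fin M → ℝ}
    (hρ : ρ ∈ stdSimplex ℝ (Fin M)) {L : ℝ} (hL : 0 ≤ L) {W : (Fin M → ℝ) → ℝ≥0∞}
    (hW : Measurable W)
    (hdeclare : ∀ ρ ∈ stdSimplex ℝ (Fin M), ∀ j, W ρ ≤ ENNReal.ofReal (L * (1 - ρ j)))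
    (hstep : ∀ ρ ∈ stdSimplex ℝ (Fin M), ∀ a,
      W ρ ≤ 1 + ∫⁻ z, W (P.posterior a ρ z) * ENNReal.ofReal (P.mix a ρ z) ∂P.ref) (n : ℕ) :
    remaining P π ρ W n ≤
      survival P π ρ n + ENNReal.ofReal L * errorAt P π ρ n + remaining P π ρ W (n + 1) := by
  classical
  obtain ⟨T, hT, hTeq⟩ : ∃ T, MeasurableSet T ∧ history n ⁻¹' T = {ω | π.τ ω = (n : ℕ∞)} :=
    π.isStoppingTime_τ.measurableSet_eq n
  obtain ⟨N, hN, hNeq⟩ : ∃ N, MeasurableSet N ∧ history n ⁻¹' N = {ω | (n : ℕ∞) < π.τ ω} :=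
    π.isStoppingTime_τ.measurableSet_gt n
  have hT' : ∀ ω, history n ω ∈ T ↔ π.τ ω = (n : ℕ∞) := fun ω => Set.ext_iff.1 hTeq ω
  have hN' : ∀ ω, history n ω ∈ N ↔ (n : ℕ∞) < π.τ ω := fun ω => Set.ext_iff.1 hNeq ω
  have hWb := hW.comp (P.measurable_belief ρ n)
  have hWb1 := hW.comp (P.measurable_belief ρ (n + 1))
  have hinit : Measurable fun h : Fin (n + 1) → A × Z => fun k : Fin n => h k.castSucc :=
    measurable_pi_lambda _ fun k => measurable_pi_apply _
  -- the three terms on the right-hand side as Bayesian expectations of functions of the record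
  have hS : survival P π ρ n = bayesExp P π ρ n fun _ => N.indicator 1 := by
    unfold survival bayesExp
    refine Finset.sum_congr rfl fun i _ => ?_
    rw [← lintegral_indicator_one (π.measurableSet_lt_tau n), ← hNeq]
    rfl
  have hE : ENNReal.ofReal L * errorAt P π ρ n = bayesExp P π ρ n fun i h =>
      ENNReal.ofReal L * (T ∩ {h | π.declare n h ≠ i}).indicator 1 h := by
    rw [bayesExp_const_mul _ _ _ _ ENNReal.ofReal_ne_top]
    congr 1
    unfold errorAt bayesExp
    refine Finset.sum_congr rfl fun i _ => ?_
    rw [← lintegral_indicator_one (π.measurableSet_wrongAt n i)]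
    congr 1
    refine lintegral_congr fun ω => ?_
    simp only [Set.indicator_apply, Set.mem_inter_iff, Set.mem_ofPred_eq, hT', Pi.one_apply]
  have hdecl : ∀ i, Measurable fun h : Fin n → A × Z =>
      ENNReal.ofReal L * (T ∩ {h | π.declare n h ≠ i}).indicator 1 h := fun i =>
    (measurable_one.indicator
      (hT.inter ((π.measurable_declare n) (measurableSet_singleton i).compl))).const_mul _
  have hR : remaining P π ρ W (n + 1) = bayesExp P π ρ (n + 1) fun _ h =>
      N.indicator 1 (fun k : Fin n => h k.castSucc) * W (P.belief ρ (n + 1) h) := by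
    unfold remaining bayesExp
    refine Finset.sum_congr rfl fun i _ => ?_
    congr 1
    refine lintegral_congr fun ω => ?_
    have h1 : (fun k : Fin n => history (n + 1) ω k.castSucc) = history n ω := rfl
    simp only [Set.indicator_apply, Set.mem_ofPred_eq, h1, hN', Pi.one_apply, Nat.cast_add,
      Nat.cast_one, ENat.add_one_le_iff (ENat.natCast_ne_top n)]
    split_ifs <;> simp
  have hL0 : remaining P π ρ W n = bayesExp P π ρ n fun _ h =>
      T.indicator (W ∘ P.belief ρ n) h + N.indicator (W ∘ P.belief ρ n) h := by
    unfold remaining bayesExp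
    refine Finset.sum_congr rfl fun i _ => ?_
    congr 1
    refine lintegral_congr fun ω => ?_
    simp only [Set.indicator_apply, Set.mem_ofPred_eq, hT', hN', Function.comp]
    rcases lt_trichotomy (π.τ ω) (n : ℕ∞) with h | h | h
    · simp [h.not_ge, h.ne, h.le.not_gt]
    · simp [h]
    · simp [h.le, h.ne', h]
  have hg : Measurable fun h : Fin (n + 1) → A × Z =>
      N.indicator 1 (fun k : Fin n => h k.castSucc) * W (P.belief ρ (n + 1) h) :=
    ((measurable_one.indicator hN).comp hinit).mul hWb1
  rw [hL0, bayesExp_add _ _ _ _ fun _ => hWb.indicator hT, add_comm, add_right_comm]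
  refine add_le_add ?_ ?_
  · rw [hS, hR, bayesExp_succ_mix P π hρ n hg,
      ← bayesExp_add _ _ _ _ fun _ => measurable_one.indicator hN]
    refine bayesExp_mono _ _ _ _ fun _ h => ?_
    by_cases hh : h ∈ N
    · simp only [Set.indicator_of_mem hh, Fin.snoc_castSucc, Pi.one_apply, one_mul,
        ObsModel.belief_snoc, Function.comp]
      have hb := P.belief_mem hρ n h
      calc W (P.belief ρ n h) = ∫⁻ _, W (P.belief ρ n h) ∂π.act n h := by simp
        _ ≤ ∫⁻ a, (1 + ∫⁻ z, W (P.posterior a (P.belief ρ n h) z) *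
            ENNReal.ofReal (P.mix a (P.belief ρ n h) z) ∂P.ref) ∂π.act n h :=
          lintegral_mono fun a => hstep _ hb a
        _ = _ := by rw [lintegral_add_left measurable_const]; simp
    · simp [Set.indicator_of_notMem hh]
  · rw [hE, bayesExp_eq_belief P π hρ n hdecl]
    refine bayesExp_mono _ _ _ _ fun _ h => ?_
    by_cases hh : h ∈ T
    · have hb := P.belief_mem hρ n h
      rw [Set.indicator_of_mem hh]
      refine (hdeclare _ hb (π.declare n h)).trans ?_
      have h1 : L * (1 - P.belief ρ n h (π.declare n h)) =
          ∑ j, P.belief ρ n h j * (L * if π.declare n h ≠ j then 1 else 0) := by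
        have h2 := Finset.add_sum_erase _ (P.belief ρ n h) (Finset.mem_univ (π.declare n h))
        rw [hb.2] at h2
        rw [show 1 - P.belief ρ n h (π.declare n h) = _ from sub_eq_of_eq_add' h2.symm]
        simp only [ne_eq, ite_not, mul_ite, mul_zero, mul_one]
        rw [← Finset.add_sum_erase _ _ (Finset.mem_univ (π.declare n h)), if_pos rfl, zero_add,
          Finset.mul_sum]
        refine Finset.sum_congr rfl fun j hj => ?_
        rw [if_neg (Finset.ne_of_mem_erase hj).symm, mul_comm]
      rw [h1, ENNReal.ofReal_sum_of_nonneg fun j _ => by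
        have := hb.1 j
        split_ifs <;> positivity]
      refine Finset.sum_le_sum fun j _ => ?_
      rw [ENNReal.ofReal_mul (hb.1 j), ENNReal.ofReal_mul hL]
      gcongr
      simp only [Set.indicator_apply, Set.mem_inter_iff, hh, true_and, Set.mem_ofPred_eq,
        Pi.one_apply]
      split_ifs <;> simp
    · simp [Set.indicator_of_notMem hh]

/-- Verification: a function of the belief that is at most the cost of stopping, and at most the cost
of one observation plus its own expected value at the next belief, is a lower bound for `V*`. -/
theorem le_Vstar_of_bellman (P : ObsModel (Fin M) A Z) {L : ℝ} (hL : 0 ≤ L)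
    {W : (Fin M → ℝ) → ℝ≥0∞} (hW : Measurable W)
    (hdeclare : ∀ ρ ∈ stdSimplex ℝ (Fin M), ∀ j, W ρ ≤ ENNReal.ofReal (L * (1 - ρ j)))
    (hstep : ∀ ρ ∈ stdSimplex ℝ (Fin M), ∀ a,
      W ρ ≤ 1 + ∫⁻ z, W (P.posterior a ρ z) * ENNReal.ofReal (P.mix a ρ z) ∂P.ref)
    {ρ : Fin M → ℝ} (hρ : ρ ∈ stdSimplex ℝ (Fin M)) : W ρ ≤ Vstar P L ρ := by
  refine le_iInf fun π => ?_
  by_cases htop : ∫⁻ x, (π.τ x.2 : ℝ≥0∞) ∂jointLaw P π ρ = ∞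
  · simp [cost, htop]
  have hB : ∀ ρ ∈ stdSimplex ℝ (Fin M), W ρ ≤ ENNReal.ofReal L := fun ρ hρ => by
    obtain ⟨j, -, -⟩ : ∃ j ∈ Finset.univ, ρ j ≠ 0 := Finset.exists_ne_zero_of_sum_ne_zero
      (by rw [hρ.2]; exact one_ne_zero)
    refine (hdeclare ρ hρ j).trans (ENNReal.ofReal_le_ofReal ?_)
    nlinarith [hρ.1 j]
  have hind : ∀ n, W ρ ≤ (∑ k ∈ Finset.range n, survival P π ρ k) +
      ENNReal.ofReal L * (∑ k ∈ Finset.range n, errorAt P π ρ k) + remaining P π ρ W n := by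
    intro n
    induction n with
    | zero => simp [remaining_zero P π hρ W]
    | succ n ih =>
      refine ih.trans ?_
      rw [Finset.sum_range_succ, Finset.sum_range_succ, mul_add]
      refine (add_le_add_right (remaining_le P π hρ hL hW hdeclare hstep n) _).trans (le_of_eq ?_)
      ring
  have hle : ∀ n, W ρ ≤ cost P L ρ π + ENNReal.ofReal L * survival P π ρ n := fun n => by
    refine (hind (n + 1)).trans ?_
    unfold cost
    gcongr
    · exact sum_survival_le P π ρ _
    · exact sum_errorAt_le P π ρ _
    · exact remaining_succ_le P π ρ hρ hB n
  have hsum : ∑' k, survival P π ρ k ≠ ∞ := by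
    refine ne_top_of_le_ne_top htop ?_
    rw [ENNReal.tsum_eq_iSup_nat]
    exact iSup_le fun n => sum_survival_le P π ρ n
  have hlim : Filter.Tendsto (fun n => cost P L ρ π + ENNReal.ofReal L * survival P π ρ n)
      Filter.atTop (nhds (cost P L ρ π + ENNReal.ofReal L * 0)) :=
    tendsto_const_nhds.add (ENNReal.Tendsto.const_mul
      (ENNReal.tendsto_atTop_zero_of_tsum_ne_top hsum) (Or.inr ENNReal.ofReal_ne_top))
  simpa using ge_of_tendsto' hlim hle

end Verification

/-! ### Entropy, Gibbs' inequality and Fano's inequality -/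

section Entropy

theorem mul_logb_inv_lt {p r : ℝ} (hp : 0 ≤ p) (hr : 0 < r) (hne : p ≠ r) :
    p * Real.logb 2 (1 / p) < p * Real.logb 2 (1 / r) + (r - p) / Real.log 2 := by
  have h2 : 0 < Real.log 2 := Real.log_pos one_lt_two
  rcases hp.eq_or_lt with rfl | hp
  · simpa using div_pos hr h2
  · have h1 := Real.log_lt_sub_one_of_pos (div_pos hr hp)
      (fun h => hne ((div_eq_one_iff_eq hp.ne').1 h).symm)
    rw [Real.log_div hr.ne' hp.ne'] at h1
    have h3 : p * (Real.log r - Real.log p) < r - p := by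
      calc p * (Real.log r - Real.log p) < p * (r / p - 1) := by gcongr
        _ = r - p := by field_simp
    simp only [Real.logb, one_div, Real.log_inv]
    rw [mul_div_assoc', mul_div_assoc', ← add_div]
    exact div_lt_div_of_pos_right (by linarith) h2

theorem mul_logb_inv_le {p r : ℝ} (hp : 0 ≤ p) (hr : 0 < r) :
    p * Real.logb 2 (1 / p) ≤ p * Real.logb 2 (1 / r) + (r - p) / Real.log 2 := by
  by_cases h : p = r
  · simp [h]
  · exact (mul_logb_inv_lt hp hr h).le

/-- Gibbs' inequality. -/
theorem entropy_le_cross {n : ℕ} {ρ r : Fin n → ℝ} (hρ : ρ ∈ stdSimplex ℝ (Fin n))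
    (hr : ∀ i, 0 < r i) (hr1 : ∑ i, r i = 1) :
    entropy ρ ≤ ∑ i, ρ i * Real.logb 2 (1 / r i) := by
  have h := Finset.sum_le_sum fun i (_ : i ∈ Finset.univ) => mul_logb_inv_le (hρ.1 i) (hr i)
  rw [Finset.sum_add_distrib, ← Finset.sum_div, Finset.sum_sub_distrib, hr1, hρ.2] at h
  simpa [entropy] using h

theorem entropy_lt_cross {n : ℕ} {ρ r : Fin n → ℝ} (hρ : ρ ∈ stdSimplex ℝ (Fin n))
    (hr : ∀ i, 0 < r i) (hr1 : ∑ i, r i = 1) (hne : ρ ≠ r) :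
    entropy ρ < ∑ i, ρ i * Real.logb 2 (1 / r i) := by
  obtain ⟨k, hk⟩ := Function.ne_iff.1 hne
  have h := Finset.sum_lt_sum (fun i (_ : i ∈ Finset.univ) => mul_logb_inv_le (hρ.1 i) (hr i))
    ⟨k, Finset.mem_univ k, mul_logb_inv_lt (hρ.1 k) (hr k) hk⟩
  rw [Finset.sum_add_distrib, ← Finset.sum_div, Finset.sum_sub_distrib, hr1, hρ.2] at h
  simpa [entropy] using h

theorem mul_logb_inv_nonneg {p : ℝ} (hp : 0 ≤ p) (hp1 : p ≤ 1) : 0 ≤ p * Real.logb 2 (1 / p) := by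
  rcases hp.eq_or_lt with rfl | hp0
  · simp
  · exact mul_nonneg hp (Real.logb_nonneg one_lt_two ((one_le_div hp0).2 hp1))

theorem le_one_of_mem_stdSimplex {n : ℕ} {ρ : Fin n → ℝ} (hρ : ρ ∈ stdSimplex ℝ (Fin n))
    (i : Fin n) : ρ i ≤ 1 := by
  rw [← hρ.2]
  exact Finset.single_le_sum (fun j _ => hρ.1 j) (Finset.mem_univ i)

theorem add_le_one_of_mem_stdSimplex {n : ℕ} {ρ : Fin n → ℝ} (hρ : ρ ∈ stdSimplex ℝ (Fin n))
    {i j : Fin n} (hij : i ≠ j) : ρ i + ρ j ≤ 1 := by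
  rw [← hρ.2, ← Finset.sum_pair hij]
  exact Finset.sum_le_sum_of_subset_of_nonneg (Finset.subset_univ _) fun k _ _ => hρ.1 k

theorem entropy_nonneg {n : ℕ} {ρ : Fin n → ℝ} (hρ : ρ ∈ stdSimplex ℝ (Fin n)) :
    0 ≤ entropy ρ :=
  Finset.sum_nonneg fun i _ => mul_logb_inv_nonneg (hρ.1 i) (le_one_of_mem_stdSimplex hρ i)

theorem entropy_le_logb {n : ℕ} {ρ : Fin n → ℝ} (hρ : ρ ∈ stdSimplex ℝ (Fin n)) :
    entropy ρ ≤ Real.logb 2 n := by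
  have hn : n ≠ 0 := by
    rintro rfl
    simpa using hρ.2
  refine (entropy_le_cross hρ (r := fun _ => 1 / (n : ℝ)) (fun _ => by positivity)
    (by simp [hn])).trans (le_of_eq ?_)
  rw [← Finset.sum_mul, hρ.2]
  simp

theorem measurable_entropy (n : ℕ) : Measurable fun ρ : Fin n → ℝ => entropy ρ := by
  unfold entropy Real.logb
  fun_prop

theorem entropy_pair (r : ℝ) :
    entropy ![r, 1 - r] = r * Real.logb 2 (1 / r) + (1 - r) * Real.logb 2 (1 / (1 - r)) := by
  simp [entropy]
  ring

/-- Fano's inequality with a free parameter `r`: the tangent at `r` of the concave function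
`ε ↦ h(ε) + ε log (M - 1)`, evaluated at `ε = 1 - ρ j`, bounds the entropy. -/
theorem entropy_le_tangent {M : ℕ} (hM : 2 ≤ M) {ρ : Fin M → ℝ} (hρ : ρ ∈ stdSimplex ℝ (Fin M))
    (j : Fin M) {r : ℝ} (hr0 : 0 < r) (hr1 : r < 1) :
    entropy ρ ≤ entropy ![r, 1 - r] + r * Real.logb 2 ((M : ℝ) - 1) +
      (1 - ρ j - r) * (Real.logb 2 ((1 - r) / r) + Real.logb 2 ((M : ℝ) - 1)) := by
  have hM' : (2 : ℝ) ≤ M := by exact_mod_cast hM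
  have hM1 : (0 : ℝ) < (M : ℝ) - 1 := by linarith
  have hcard : ((Finset.univ.erase j).card : ℝ) = (M : ℝ) - 1 := by
    rw [Finset.card_erase_of_mem (Finset.mem_univ j), Finset.card_univ, Fintype.card_fin,
      Nat.cast_sub (by omega), Nat.cast_one]
  have h1 := entropy_le_cross hρ (r := fun i => if i = j then 1 - r else r / ((M : ℝ) - 1))
    (fun i => by split_ifs; exacts [by linarith, by positivity]) (by
      rw [← Finset.add_sum_erase _ _ (Finset.mem_univ j), if_pos rfl,
        Finset.sum_congr rfl fun i hi => if_neg (Finset.ne_of_mem_erase hi), Finset.sum_const,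
        nsmul_eq_mul, hcard]
      field_simp
      ring)
  have h2 : ∑ i, ρ i * Real.logb 2 (1 / if i = j then 1 - r else r / ((M : ℝ) - 1)) =
      ρ j * Real.logb 2 (1 / (1 - r)) + (1 - ρ j) * Real.logb 2 (1 / (r / ((M : ℝ) - 1))) := by
    have h3 := Finset.add_sum_erase _ ρ (Finset.mem_univ j)
    rw [hρ.2] at h3
    rw [← Finset.add_sum_erase _ _ (Finset.mem_univ j), if_pos rfl,
      Finset.sum_congr rfl fun i hi => by rw [if_neg (Finset.ne_of_mem_erase hi)],
      ← Finset.sum_mul, ← h3, add_sub_cancel_left]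
  rw [h2] at h1
  refine h1.trans (le_of_eq ?_)
  have hr1' : 0 < 1 - r := by linarith
  rw [entropy_pair, one_div_div, Real.logb_div hM1.ne' hr0.ne', Real.logb_div hr1'.ne' hr0.ne',
    one_div, one_div, Real.logb_inv, Real.logb_inv]
  ring

end Entropy

/-! ### Mutual information -/

section MutualInfo

variable {M : ℕ} {A : Type u} {Z : Type v} [MeasurableSpace Z]

theorem ObsModel.integrable_q (P : ObsModel (Fin M) A Z) (a : A) (i : Fin M) :
    Integrable (fun z => (P.q a i z : ℝ)) P.ref := by
  refine ⟨(P.measurable_qReal a i).aestronglyMeasurable, ?_⟩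
  simp [HasFiniteIntegral, P.lintegral_q]

theorem ObsModel.integral_q (P : ObsModel (Fin M) A Z) (a : A) (i : Fin M) :
    ∫ z, (P.q a i z : ℝ) ∂P.ref = 1 := by
  rw [integral_eq_lintegral_of_nonneg_ae (Filter.Eventually.of_forall fun z => NNReal.coe_nonneg _)
    (P.measurable_qReal a i).aestronglyMeasurable]
  simp [P.lintegral_q]

theorem ObsModel.integrable_mix (P : ObsModel (Fin M) A Z) (a : A) (ρ : Fin M → ℝ) :
    Integrable (P.mix a ρ) P.ref :=
  integrable_finsetSum _ fun i _ => (P.integrable_q a i).const_mul _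

theorem ObsModel.integral_mix (P : ObsModel (Fin M) A Z) (a : A) {ρ : Fin M → ℝ}
    (hρ : ρ ∈ stdSimplex ℝ (Fin M)) : ∫ z, P.mix a ρ z ∂P.ref = 1 := by
  unfold ObsModel.mix
  rw [integral_finsetSum _ fun i _ => (P.integrable_q a i).const_mul _]
  simp_rw [integral_const_mul, P.integral_q, mul_one]
  exact hρ.2

theorem ObsModel.integrable_entropy_posterior (P : ObsModel (Fin M) A Z) (a : A) {ρ : Fin M → ℝ}
    (hρ : ρ ∈ stdSimplex ℝ (Fin M)) :
    Integrable (fun z => entropy (P.posterior a ρ z) * P.mix a ρ z) P.ref := by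
  refine (P.integrable_mix a ρ).bdd_mul (c := Real.logb 2 M)
    ((measurable_entropy M).comp (P.measurable_posterior a ρ)).aestronglyMeasurable
    (Filter.Eventually.of_forall fun z => ?_)
  have h := P.posterior_mem a hρ z
  simpa [Real.norm_eq_abs, abs_of_nonneg (entropy_nonneg h)] using entropy_le_logb h

theorem ObsModel.mutualInfo_le_logb (P : ObsModel (Fin M) A Z) (a : A) {ρ : Fin M → ℝ}
    (hρ : ρ ∈ stdSimplex ℝ (Fin M)) : P.mutualInfo a ρ ≤ Real.logb 2 M := by
  have h : 0 ≤ P.T a entropy ρ := integral_nonneg fun z =>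
    mul_nonneg (entropy_nonneg (P.posterior_mem a hρ z)) (P.mix_nonneg a hρ z)
  have := entropy_le_logb hρ
  unfold ObsModel.mutualInfo
  linarith

theorem ObsModel.mutualInfo_le_Imax (P : ObsModel (Fin M) A Z) (a : A) {ρ : Fin M → ℝ}
    (hρ : ρ ∈ stdSimplex ℝ (Fin M)) : P.mutualInfo a ρ ≤ P.Imax :=
  le_ciSup (f := fun p : A × stdSimplex ℝ (Fin M) => P.mutualInfo p.1 p.2.1)
    ⟨Real.logb 2 M, by rintro _ ⟨p, rfl⟩; exact P.mutualInfo_le_logb p.1 p.2.2⟩ (a, ⟨ρ, hρ⟩)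

/-- Under the uniform prior an action that separates two hypotheses is informative, because the uniform
distribution is the only one of maximal entropy. -/
theorem ObsModel.Imax_pos (P : ObsModel (Fin M) A Z) (hM : 2 ≤ M) (hP : P.Distinguishable) :
    0 < P.Imax := by
  by_contra! hI
  obtain ⟨a, ha⟩ := hP ⟨0, by omega⟩ ⟨1, by omega⟩ (by simp)
  set i : Fin M := ⟨0, by omega⟩
  set j : Fin M := ⟨1, by omega⟩
  have hM0 : (0 : ℝ) < M := by exact_mod_cast (by omega : 0 < M)
  set r : Fin M → ℝ := fun _ => 1 / (M : ℝ) with hr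
  have hr1 : ∑ i, r i = 1 := by simp [hr, hM0.ne']
  have hrm : r ∈ stdSimplex ℝ (Fin M) := ⟨fun _ => by positivity, hr1⟩
  have hcross : ∀ {ρ : Fin M → ℝ}, ρ ∈ stdSimplex ℝ (Fin M) →
      ∑ i, ρ i * Real.logb 2 (1 / r i) = Real.logb 2 M := fun h => by
    simp only [hr]
    rw [← Finset.sum_mul, h.2]
    simp
  have hHr : entropy r = Real.logb 2 M := hcross hrm
  have hle := (P.mutualInfo_le_Imax a hrm).trans hI
  have hint : ∫ z, (Real.logb 2 M - entropy (P.posterior a r z)) * P.mix a r z ∂P.ref ≤ 0 := by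
    simp_rw [sub_mul]
    rw [integral_sub ((P.integrable_mix a r).const_mul _) (P.integrable_entropy_posterior a hrm),
      integral_const_mul, P.integral_mix a hrm, mul_one]
    unfold ObsModel.mutualInfo at hle
    rw [hHr] at hle
    exact hle
  have hnn : 0 ≤ fun z => (Real.logb 2 M - entropy (P.posterior a r z)) * P.mix a r z := fun z =>
    mul_nonneg (sub_nonneg.2 (entropy_le_logb (P.posterior_mem a hrm z))) (P.mix_nonneg a hrm z)
  have hae := (integral_eq_zero_iff_of_nonneg hnn (by
    simp_rw [sub_mul]
    exact ((P.integrable_mix a r).const_mul _).sub (P.integrable_entropy_posterior a hrm))).1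
    (le_antisymm hint (integral_nonneg hnn))
  have hq : (fun z => (P.q a i z : ℝ≥0∞)) =ᵐ[P.ref] fun z => (P.q a j z : ℝ≥0∞) := by
    filter_upwards [hae] with z hz
    have hpost : P.posterior a r z i * P.mix a r z = P.posterior a r z j * P.mix a r z := by
      rcases mul_eq_zero.1 hz with h | h
      · have hpr : P.posterior a r z = r := by
          by_contra hne
          have h1 := entropy_lt_cross (P.posterior_mem a hrm z) (fun _ => by positivity) hr1 hne
          rw [hcross (P.posterior_mem a hrm z)] at h1
          linarith
        rw [hpr]
      · rw [h, mul_zero, mul_zero]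
    rw [P.posterior_mul_mix a hrm, P.posterior_mul_mix a hrm] at hpost
    have : (P.q a i z : ℝ) = P.q a j z := mul_left_cancel₀ (by positivity) hpost
    exact_mod_cast this
  have hobs : P.obs i a = P.obs j a := withDensity_congr_ae hq
  have : P.D a i j = 0 := by rw [ObsModel.D, hobs, InformationTheory.klDiv_self, ENNReal.zero_div]
  exact ha.ne' this

end MutualInfo

/-! ### The entropy bound -/

section EntropyBound

variable {M : ℕ} {A : Type u} {Z : Type v} [MeasurableSpace Z]

theorem ofReal_integral_le_lintegral {α : Type*} [MeasurableSpace α] (μ : Measure α) (f : α → ℝ) :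
    ENNReal.ofReal (∫ x, f x ∂μ) ≤ ∫⁻ x, ENNReal.ofReal (f x) ∂μ := by
  by_cases hf : Integrable f μ
  · rw [integral_eq_lintegral_pos_part_sub_lintegral_neg_part hf]
    refine (ENNReal.ofReal_le_ofReal (sub_le_self _ ENNReal.toReal_nonneg)).trans ?_
    exact ENNReal.ofReal_toReal_le
  · simp [integral_undef hf]

/-- A real Bellman inequality for `f` gives one for its positive part, and for any function that
dominates `f` at the beliefs that can be reached in one step. -/
theorem ObsModel.bellman_of_integral (P : ObsModel (Fin M) A Z) (a : A) {ρ : Fin M → ℝ}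
    (hρ : ρ ∈ stdSimplex ℝ (Fin M)) {f : (Fin M → ℝ) → ℝ} {W : (Fin M → ℝ) → ℝ≥0∞}
    (hf : f ρ ≤ 1 + P.T a f ρ)
    (hW : ∀ z, P.mix a ρ z ≠ 0 → ENNReal.ofReal (f (P.posterior a ρ z)) ≤ W (P.posterior a ρ z)) :
    ENNReal.ofReal (f ρ) ≤
      1 + ∫⁻ z, W (P.posterior a ρ z) * ENNReal.ofReal (P.mix a ρ z) ∂P.ref := by
  refine (ENNReal.ofReal_le_ofReal hf).trans (ENNReal.ofReal_add_le.trans ?_)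
  rw [ENNReal.ofReal_one]
  gcongr
  refine (ofReal_integral_le_lintegral _ _).trans (lintegral_mono fun z => ?_)
  rw [ENNReal.ofReal_mul' (P.mix_nonneg a hρ z)]
  by_cases h : P.mix a ρ z = 0
  · simp [h]
  · gcongr
    exact hW z h

/-- Divided by `I_max`, the entropy decreases by at most one bit per observation on average. -/
theorem ObsModel.entropy_bellman (P : ObsModel (Fin M) A Z) (hI : 0 < P.Imax) (a : A)
    {ρ : Fin M → ℝ} (hρ : ρ ∈ stdSimplex ℝ (Fin M)) (b c : ℝ) :
    (entropy ρ - b) / P.Imax + c ≤ 1 + P.T a (fun ρ => (entropy ρ - b) / P.Imax + c) ρ := by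
  have hint := P.integrable_entropy_posterior a hρ
  have hT : P.T a (fun ρ => (entropy ρ - b) / P.Imax + c) ρ =
      (P.T a entropy ρ - b) / P.Imax + c := by
    have h1 : ∀ z, ((entropy (P.posterior a ρ z) - b) / P.Imax + c) * P.mix a ρ z =
        P.Imax⁻¹ * (entropy (P.posterior a ρ z) * P.mix a ρ z) +
          (c - b / P.Imax) * P.mix a ρ z := fun z => by ring
    unfold ObsModel.T
    simp_rw [h1]
    rw [integral_add (hint.const_mul _) ((P.integrable_mix a ρ).const_mul _), integral_const_mul,
      integral_const_mul, P.integral_mix a hρ]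
    ring
  rw [hT]
  have h2 := P.mutualInfo_le_Imax a hρ
  unfold ObsModel.mutualInfo at h2
  have h3 : (entropy ρ - b) / P.Imax ≤ 1 + (P.T a entropy ρ - b) / P.Imax := by
    rw [div_le_iff₀ hI, add_mul, div_mul_cancel₀ _ hI.ne']
    linarith
  linarith

theorem two_le_of_mem_region {L : ℝ} {ρ : Fin M → ℝ} (hρ : ρ ∈ region M L) : 2 ≤ M := by
  obtain ⟨h1, h2⟩ := hρ
  by_contra! h
  interval_cases M
  · simpa using h1.2
  · have h3 := h2 0
    have h4 : ρ 0 = 1 := by simpa using h1.2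
    rw [h4] at h3
    norm_num at h3

theorem entropy_bound_le_Vstar [Finite A] [MeasurableSpace A] [MeasurableSingletonClass A]
    (P : ObsModel (Fin M) A Z) (hP : P.Distinguishable) {L : ℝ} (hL : 1 < L) {ρ : Fin M → ℝ}
    (hρ : ρ ∈ region M L) :
    ENNReal.ofReal ((entropy ρ - entropy ![P.alpha L, 1 - P.alpha L]
        - P.alpha L * Real.logb 2 ((M : ℝ) - 1)) / P.Imax + P.alpha L * L) ≤ Vstar P L ρ := by
  have hM := two_le_of_mem_region hρ
  have hI := P.Imax_pos hM hP
  have hM' : (2 : ℝ) ≤ M := by exact_mod_cast hM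
  have hM1 : (0 : ℝ) < (M : ℝ) - 1 := by linarith
  have hx : 0 < (2 : ℝ) ^ (L * P.Imax) := by positivity
  have hα0 : 0 < P.alpha L := div_pos hM1 (by positivity)
  have hα : 1 - P.alpha L = (2 : ℝ) ^ (L * P.Imax) / ((M : ℝ) - 1 + 2 ^ (L * P.Imax)) := by
    unfold ObsModel.alpha
    field_simp
    ring
  have hα1 : P.alpha L < 1 := by
    have : 0 < 1 - P.alpha L := by rw [hα]; positivity
    linarith
  -- `α` is the error probability at which the slope of Fano's bound equals `L * I_max`
  have hslope : Real.logb 2 ((1 - P.alpha L) / P.alpha L) + Real.logb 2 ((M : ℝ) - 1) =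
      L * P.Imax := by
    have h1 : (1 - P.alpha L) / P.alpha L = (2 : ℝ) ^ (L * P.Imax) / ((M : ℝ) - 1) := by
      rw [hα]
      unfold ObsModel.alpha
      field_simp
    rw [h1, Real.logb_div hx.ne' hM1.ne', Real.logb_rpow (by norm_num) (by norm_num)]
    ring
  set b := entropy ![P.alpha L, 1 - P.alpha L] + P.alpha L * Real.logb 2 ((M : ℝ) - 1) with hb
  rw [sub_sub, ← hb]
  refine le_Vstar_of_bellman P (by linarith)
    (W := fun ρ => ENNReal.ofReal ((entropy ρ - b) / P.Imax + P.alpha L * L))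
    ((((measurable_entropy M).sub_const _).div_const _).add_const _).ennreal_ofReal ?_ ?_ hρ.1
  · intro ρ hρ j
    refine ENNReal.ofReal_le_ofReal ?_
    have h1 := entropy_le_tangent hM hρ j hα0 hα1
    rw [hslope, ← hb] at h1
    have h2 : (entropy ρ - b) / P.Imax ≤ (1 - ρ j - P.alpha L) * L := by
      rw [div_le_iff₀ hI]
      linarith
    linarith
  · intro ρ hρ a
    exact P.bellman_of_integral a hρ
      (f := fun ρ => (entropy ρ - b) / P.Imax + P.alpha L * L)
      (W := fun ρ => ENNReal.ofReal ((entropy ρ - b) / P.Imax + P.alpha L * L))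
      (P.entropy_bellman hI a hρ b _) fun z _ => le_rfl

end EntropyBound

/-! ### Divergences under bounded log-likelihood ratios -/

section Divergence

variable {M : ℕ} {A : Type u} {Z : Type v} [MeasurableSpace Z]

theorem ObsModel.BoundedLLR.q_pos {P : ObsModel (Fin M) A Z} {ξ : ℝ} (hξ : P.BoundedLLR ξ)
    {a : A} {i : Fin M} (j : Fin M) {z : Z} (h : 0 < P.q a i z) : 0 < P.q a j z := by
  by_contra h0
  have h1 := hξ i j a z
  rw [logRatio, if_pos (le_antisymm (not_lt.1 h0) zero_le), if_neg h.ne'] at h1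
  exact absurd h1 (by simp)

theorem ObsModel.BoundedLLR.logb_le {P : ObsModel (Fin M) A Z} {ξ : ℝ} (hξ : P.BoundedLLR ξ)
    {a : A} {i : Fin M} (j : Fin M) {z : Z} (h : 0 < P.q a i z) :
    Real.logb 2 (P.q a i z / P.q a j z) ≤ ξ := by
  have h1 := hξ i j a z
  rw [logRatio, if_neg (hξ.q_pos j h).ne', if_neg h.ne'] at h1
  exact_mod_cast h1

theorem ObsModel.BoundedLLR.abs_logb_le {P : ObsModel (Fin M) A Z} {ξ : ℝ} (hξ : P.BoundedLLR ξ)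
    {a : A} {i : Fin M} (j : Fin M) {z : Z} (h : 0 < P.q a i z) :
    |Real.logb 2 (P.q a i z / P.q a j z)| ≤ ξ := by
  refine abs_le.2 ⟨?_, hξ.logb_le j h⟩
  have h1 := hξ.logb_le i (hξ.q_pos j h)
  rw [← inv_div, Real.logb_inv] at h1
  linarith

theorem ObsModel.BoundedLLR.q_le {P : ObsModel (Fin M) A Z} {ξ : ℝ} (hξ : P.BoundedLLR ξ)
    (a : A) (i j : Fin M) (z : Z) : (P.q a i z : ℝ) ≤ 2 ^ ξ * P.q a j z := by
  rcases (zero_le (a := P.q a i z)).eq_or_lt with h | h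
  · rw [← h]
    simp only [NNReal.coe_zero]
    positivity
  · have hj := hξ.q_pos j h
    have h1 := hξ.logb_le j h
    rw [Real.logb_le_iff_le_rpow one_lt_two (by positivity), div_le_iff₀ (by positivity)] at h1
    exact h1

theorem ObsModel.BoundedLLR.nonneg {P : ObsModel (Fin M) A Z} {ξ : ℝ} (hξ : P.BoundedLLR ξ)
    (a : A) (i : Fin M) : 0 ≤ ξ := by
  obtain ⟨z, hz⟩ : ∃ z, 0 < P.q a i z := by
    by_contra! h
    have h1 := P.lintegral_q a i
    simp [fun z => le_antisymm (h z) zero_le] at h1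
  have h1 := hξ.logb_le i hz
  rwa [div_self (by positivity), Real.logb_one] at h1

theorem ObsModel.BoundedLLR.integrable_q_mul_logb {P : ObsModel (Fin M) A Z} {ξ : ℝ}
    (hξ : P.BoundedLLR ξ) (a : A) (i j : Fin M) :
    Integrable (fun z => (P.q a i z : ℝ) * Real.logb 2 (P.q a i z / P.q a j z)) P.ref := by
  refine ((P.integrable_q a i).mul_const ξ).mono' ?_ (Filter.Eventually.of_forall fun z => ?_)
  · unfold Real.logb
    have h1 := P.measurable_qReal a i
    have h2 := P.measurable_qReal a j
    exact (h1.mul ((Real.measurable_log.comp (h1.div h2)).div_const _)).aestronglyMeasurable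
  · rw [norm_mul, Real.norm_of_nonneg (NNReal.coe_nonneg _), Real.norm_eq_abs]
    rcases (zero_le (a := P.q a i z)).eq_or_lt with h | h
    · simp [← h]
    · exact mul_le_mul_of_nonneg_left (hξ.abs_logb_le j h) (NNReal.coe_nonneg _)

/-- The divergence in terms of the densities. -/
theorem ObsModel.BoundedLLR.D_eq {P : ObsModel (Fin M) A Z} {ξ : ℝ} (hξ : P.BoundedLLR ξ)
    (a : A) (i j : Fin M) : P.D a i j =
      ENNReal.ofReal (∫ z, (P.q a i z : ℝ) * Real.logb 2 (P.q a i z / P.q a j z) ∂P.ref) := by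
  have := P.sigmaFinite_ref
  have hl2 : 0 < Real.log 2 := Real.log_pos one_lt_two
  have hm : Measurable fun z => (P.q a i z : ℝ≥0∞) / P.q a j z :=
    (P.measurable_qENNReal a i).div (P.measurable_qENNReal a j)
  have hobs : P.obs i a = (P.obs j a).withDensity fun z => (P.q a i z : ℝ≥0∞) / P.q a j z := by
    rw [ObsModel.obs, ObsModel.obs, ← withDensity_mul _ (P.measurable_qENNReal a j) hm]
    congr 1
    funext z
    simp only [Pi.mul_apply]
    rcases (zero_le (a := P.q a j z)).eq_or_lt with h | h
    · have h0 : P.q a i z = 0 := by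
        by_contra hne
        exact (hξ.q_pos j (pos_iff_ne_zero.2 hne)).ne h
      simp [← h, h0]
    · exact (ENNReal.mul_div_cancel (by simpa using h.ne') ENNReal.coe_ne_top).symm
  have hac : P.obs i a ≪ P.obs j a := by
    rw [hobs]
    exact withDensity_absolutelyContinuous _ _
  have hllr : llr (P.obs i a) (P.obs j a) =ᵐ[P.obs i a]
      fun z => Real.log (P.q a i z / P.q a j z) := by
    have h1 : (P.obs i a).rnDeriv (P.obs j a) =ᵐ[P.obs j a]
        fun z => (P.q a i z : ℝ≥0∞) / P.q a j z := by
      conv_lhs => rw [hobs]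
      exact Measure.rnDeriv_withDensity _ hm
    filter_upwards [hac.ae_le h1] with z hz
    simp [llr, hz, ENNReal.toReal_div]
  have hmul : ∀ z, (P.q a i z) • Real.log (P.q a i z / P.q a j z) =
      Real.log 2 * ((P.q a i z : ℝ) * Real.logb 2 (P.q a i z / P.q a j z)) := fun z => by
    rw [NNReal.smul_def, smul_eq_mul, Real.logb]
    field_simp
  have hint : Integrable (llr (P.obs i a) (P.obs j a)) (P.obs i a) := by
    rw [integrable_congr hllr, ObsModel.obs,
      integrable_withDensity_iff_integrable_smul (P.measurable_q a i)]
    simp_rw [hmul]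
    exact (hξ.integrable_q_mul_logb a i j).const_mul _
  have hval : (InformationTheory.klDiv (P.obs i a) (P.obs j a)).toReal =
      Real.log 2 * ∫ z, (P.q a i z : ℝ) * Real.logb 2 (P.q a i z / P.q a j z) ∂P.ref := by
    rw [InformationTheory.toReal_klDiv_of_measure_eq hac (by simp), integral_congr_ae hllr,
      ObsModel.obs, integral_withDensity_eq_integral_smul (P.measurable_q a i)]
    simp_rw [hmul]
    rw [integral_const_mul]
  rw [ObsModel.D, ← ENNReal.ofReal_toReal (InformationTheory.klDiv_ne_top hac hint), hval,
    ← ENNReal.ofReal_div_of_pos hl2, mul_div_cancel_left₀ _ hl2.ne']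

theorem ObsModel.BoundedLLR.Dmax_ne_top {P : ObsModel (Fin M) A Z} {ξ : ℝ} (hξ : P.BoundedLLR ξ) :
    P.Dmax ≠ ∞ := by
  refine ne_top_of_le_ne_top (ENNReal.ofReal_ne_top (r := ξ))
    (iSup_le fun i => iSup_le fun j => iSup_le fun a => ?_)
  rw [hξ.D_eq]
  refine ENNReal.ofReal_le_ofReal ?_
  rw [← one_mul ξ, ← P.integral_q a i, ← integral_mul_const]
  refine integral_mono (hξ.integrable_q_mul_logb a i j) ((P.integrable_q a i).mul_const ξ)
    fun z => ?_
  rcases (zero_le (a := P.q a i z)).eq_or_lt with h | h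
  · simp [← h]
  · exact mul_le_mul_of_nonneg_left (hξ.logb_le j h) (NNReal.coe_nonneg _)

theorem ObsModel.BoundedLLR.integral_le_Dmax {P : ObsModel (Fin M) A Z} {ξ : ℝ}
    (hξ : P.BoundedLLR ξ) (a : A) (i j : Fin M) :
    ∫ z, (P.q a i z : ℝ) * Real.logb 2 (P.q a i z / P.q a j z) ∂P.ref ≤ P.Dmax.toReal := by
  rw [← ENNReal.ofReal_le_iff_le_toReal hξ.Dmax_ne_top, ← hξ.D_eq a i j]
  exact le_iSup_of_le i (le_iSup_of_le j (le_iSup_of_le a le_rfl))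

end Divergence

/-! ### Expected log-odds of one hypothesis against all others -/

section LogOdds

/-- The expected log-odds in favour of the truth, when a hypothesis has belief `p` and is tested
against its complement. -/
noncomputable def expectedLogOdds (p : ℝ) : ℝ := (2 * p - 1) * Real.logb 2 (p / (1 - p))

theorem expectedLogOdds_symm (p : ℝ) : expectedLogOdds (1 - p) = expectedLogOdds p := by
  unfold expectedLogOdds
  rw [sub_sub_cancel, ← inv_div p, Real.logb_inv]
  ring

theorem logb_odds_nonneg {p : ℝ} (hp : 1 / 2 ≤ p) (hp1 : p < 1) :
    0 ≤ Real.logb 2 (p / (1 - p)) :=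
  Real.logb_nonneg one_lt_two ((one_le_div (by linarith)).2 (by linarith))

theorem expectedLogOdds_nonneg {p : ℝ} (hp : 0 < p) (hp1 : p < 1) : 0 ≤ expectedLogOdds p := by
  rcases le_total (1 / 2) p with h | h
  · exact mul_nonneg (by linarith) (logb_odds_nonneg h hp1)
  · rw [← expectedLogOdds_symm]
    exact mul_nonneg (by linarith) (logb_odds_nonneg (by linarith) (by linarith))

theorem measurable_expectedLogOdds : Measurable expectedLogOdds := by
  unfold expectedLogOdds Real.logb
  fun_prop

/-- A weighted form of the convexity of the divergence in each of its arguments, at one point of the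
observation space: `g = ∑ w k * x k` is a mixture of the densities `x k`. -/
theorem symmetrized_logb_sum_le {ι : Type*} {s : Finset ι} {w x : ι → ℝ} {f b c : ℝ}
    (hw : ∀ k ∈ s, 0 ≤ w k) (hw1 : ∑ k ∈ s, w k = 1) (hx : ∀ k ∈ s, 0 < x k) (hf : 0 < f)
    (hb : 0 ≤ b) (hc : 0 ≤ c) :
    (b * f - c * ∑ k ∈ s, w k * x k) * Real.logb 2 (f / ∑ k ∈ s, w k * x k) ≤
      ∑ k ∈ s, w k * (b * (f * Real.logb 2 (f / x k)) + c * (x k * Real.logb 2 (x k / f))) := by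
  have hl2 : 0 < Real.log 2 := Real.log_pos one_lt_two
  have hconc : ∑ k ∈ s, w k * Real.log (x k) ≤ Real.log (∑ k ∈ s, w k * x k) := by
    simpa using strictConcaveOn_log_Ioi.concaveOn.le_map_sum hw hw1 hx
  have hg : 0 < ∑ k ∈ s, w k * x k := by
    refine (Finset.sum_nonneg fun k hk => mul_nonneg (hw k hk) (hx k hk).le).lt_of_ne' fun h0 => ?_
    rw [Finset.sum_eq_zero_iff_of_nonneg fun k hk => mul_nonneg (hw k hk) (hx k hk).le] at h0
    rw [Finset.sum_eq_zero fun k hk => (mul_eq_zero.1 (h0 k hk)).resolve_right (hx k hk).ne'] at hw1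
    exact zero_ne_one hw1
  have hconv : (∑ k ∈ s, w k * x k) * Real.log (∑ k ∈ s, w k * x k) ≤
      ∑ k ∈ s, w k * (x k * Real.log (x k)) := by
    simpa using Real.convexOn_mul_log.map_sum_le hw hw1 fun k hk => (hx k hk).le
  have h1 : ∑ k ∈ s, w k * (b * (f * Real.logb 2 (f / x k)) + c * (x k * Real.logb 2 (x k / f))) =
      (b * f * (Real.log f - ∑ k ∈ s, w k * Real.log (x k)) +
        c * (∑ k ∈ s, w k * (x k * Real.log (x k)) - (∑ k ∈ s, w k * x k) * Real.log f)) /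
          Real.log 2 := by
    have h2 : ∀ k ∈ s, w k * (b * (f * Real.logb 2 (f / x k)) + c * (x k * Real.logb 2 (x k / f))) =
        (b * f * Real.log f * w k - b * f * (w k * Real.log (x k)) +
          (c * (w k * (x k * Real.log (x k))) - c * Real.log f * (w k * x k))) / Real.log 2 := by
      intro k hk
      rw [Real.logb, Real.logb, Real.log_div hf.ne' (hx k hk).ne',
        Real.log_div (hx k hk).ne' hf.ne']
      field_simp
    rw [Finset.sum_congr rfl h2, ← Finset.sum_div, Finset.sum_add_distrib, Finset.sum_sub_distrib,
      Finset.sum_sub_distrib, ← Finset.mul_sum, ← Finset.mul_sum, ← Finset.mul_sum,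
      ← Finset.mul_sum, hw1]
    ring
  rw [h1, Real.logb, Real.log_div hf.ne' hg.ne', mul_div_assoc']
  refine div_le_div_of_nonneg_right ?_ hl2.le
  have h3 := mul_le_mul_of_nonneg_left hconc (mul_nonneg hb hf.le)
  have h4 := mul_le_mul_of_nonneg_left hconv hc
  linarith

variable {M : ℕ} {A : Type u} {Z : Type v} [MeasurableSpace Z]

theorem ObsModel.mix_eq_add (P : ObsModel (Fin M) A Z) (a : A) (ρ : Fin M → ℝ) (J : Fin M) (z : Z) :
    P.mix a ρ z = ρ J * P.q a J z + ∑ k ∈ Finset.univ.erase J, ρ k * P.q a k z :=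
  (Finset.add_sum_erase _ (fun k => ρ k * (P.q a k z : ℝ)) (Finset.mem_univ J)).symm

theorem ObsModel.BoundedLLR.expectedLogOdds_posterior_le {P : ObsModel (Fin M) A Z} {ξ : ℝ}
    (hξ : P.BoundedLLR ξ) (a : A) {ρ : Fin M → ℝ} (hρ : ρ ∈ stdSimplex ℝ (Fin M)) {J : Fin M}
    (h0 : 0 < ρ J) (h1 : ρ J < 1) (z : Z) :
    0 ≤ expectedLogOdds (P.posterior a ρ z J) * P.mix a ρ z ∧
    expectedLogOdds (P.posterior a ρ z J) * P.mix a ρ z ≤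
      (ρ J * P.q a J z - ∑ k ∈ Finset.univ.erase J, ρ k * P.q a k z) *
          Real.logb 2 (ρ J / (1 - ρ J)) +
        ∑ k ∈ Finset.univ.erase J, ρ k / (1 - ρ J) *
          (ρ J * (P.q a J z * Real.logb 2 (P.q a J z / P.q a k z)) +
            (1 - ρ J) * (P.q a k z * Real.logb 2 (P.q a k z / P.q a J z))) := by
  have h1' : 0 < 1 - ρ J := by linarith
  rcases (zero_le (a := P.q a J z)).eq_or_lt with h | h
  · have hk : ∀ k, P.q a k z = 0 := fun k => by
      by_contra hne
      exact (hξ.q_pos J (pos_iff_ne_zero.2 hne)).ne h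
    simp [ObsModel.mix, hk]
  · have hf : (0 : ℝ) < P.q a J z := h
    have hk : ∀ k, (0 : ℝ) < P.q a k z := fun k => hξ.q_pos k h
    have hsum : ∑ k ∈ Finset.univ.erase J, ρ k / (1 - ρ J) = 1 := by
      have h2 := Finset.add_sum_erase _ ρ (Finset.mem_univ J)
      rw [hρ.2] at h2
      rw [← Finset.sum_div, div_eq_one_iff_eq h1'.ne']
      linarith
    have hN : ∑ k ∈ Finset.univ.erase J, ρ k * P.q a k z =
        (1 - ρ J) * ∑ k ∈ Finset.univ.erase J, ρ k / (1 - ρ J) * P.q a k z := by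
      rw [Finset.mul_sum]
      refine Finset.sum_congr rfl fun k _ => ?_
      field_simp
    have hNpos : 0 < ∑ k ∈ Finset.univ.erase J, ρ k * P.q a k z := by
      obtain ⟨k, hkm, hk0⟩ : ∃ k ∈ Finset.univ.erase J, ρ k / (1 - ρ J) ≠ 0 :=
        Finset.exists_ne_zero_of_sum_ne_zero (by rw [hsum]; exact one_ne_zero)
      refine Finset.sum_pos' (fun k _ => mul_nonneg (hρ.1 k) (hk k).le) ⟨k, hkm, ?_⟩
      exact mul_pos ((hρ.1 k).lt_of_ne' fun h => hk0 (by rw [h, zero_div])) (hk k)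
    set N := ∑ k ∈ Finset.univ.erase J, ρ k * (P.q a k z : ℝ) with hNdef
    have hmix : P.mix a ρ z = ρ J * P.q a J z + N := P.mix_eq_add a ρ J z
    have hpf : 0 < ρ J * P.q a J z := mul_pos h0 hf
    have hmpos : 0 < P.mix a ρ z := by rw [hmix]; positivity
    have hpost : P.posterior a ρ z J = ρ J * P.q a J z / P.mix a ρ z := by
      rw [ObsModel.posterior, if_neg hmpos.ne']
    have hpost' : 1 - P.posterior a ρ z J = N / P.mix a ρ z := by
      rw [hpost, eq_div_iff hmpos.ne', sub_mul, div_mul_cancel₀ _ hmpos.ne', hmix]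
      ring
    have hpos : 0 < P.posterior a ρ z J := by rw [hpost]; positivity
    have hlt : P.posterior a ρ z J < 1 := by
      have : 0 < 1 - P.posterior a ρ z J := by rw [hpost']; positivity
      linarith
    refine ⟨mul_nonneg (expectedLogOdds_nonneg hpos hlt) hmpos.le, ?_⟩
    have hlhs : expectedLogOdds (P.posterior a ρ z J) * P.mix a ρ z =
        (ρ J * P.q a J z - N) * Real.logb 2 (ρ J / (1 - ρ J)) +
        (ρ J * P.q a J z - N) *
          Real.logb 2 (P.q a J z / ∑ k ∈ Finset.univ.erase J, ρ k / (1 - ρ J) * P.q a k z) := by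
      have hg : ∑ k ∈ Finset.univ.erase J, ρ k / (1 - ρ J) * P.q a k z = N / (1 - ρ J) := by
        rw [hN, mul_div_cancel_left₀ _ h1'.ne']
      rw [hg, ← mul_add, ← Real.logb_mul (by positivity) (by positivity), expectedLogOdds, hpost',
        hpost, div_div_div_cancel_right₀ hmpos.ne', mul_right_comm]
      congr 1
      · rw [sub_mul, mul_assoc, div_mul_cancel₀ _ hmpos.ne', hmix]
        ring
      · congr 1
        field_simp
    rw [hlhs]
    gcongr
    rw [hN]
    exact symmetrized_logb_sum_le (fun k _ => div_nonneg (hρ.1 k) h1'.le) hsum (fun k _ => hk k) hf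
      h0.le h1'.le

/-- The expected log-odds of hypothesis `J` against its complement grow by at most `D_max` per
observation: their mean increment is a mean of divergences between `q J` and a mixture of the other
densities, and the divergence is convex. -/
theorem ObsModel.BoundedLLR.T_expectedLogOdds_le {P : ObsModel (Fin M) A Z} {ξ : ℝ}
    (hξ : P.BoundedLLR ξ) (a : A) {ρ : Fin M → ℝ} (hρ : ρ ∈ stdSimplex ℝ (Fin M)) {J : Fin M}
    (h0 : 0 < ρ J) (h1 : ρ J < 1) :
    Integrable (fun z => expectedLogOdds (P.posterior a ρ z J) * P.mix a ρ z) P.ref ∧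
    ∫ z, expectedLogOdds (P.posterior a ρ z J) * P.mix a ρ z ∂P.ref ≤
      expectedLogOdds (ρ J) + P.Dmax.toReal := by
  have h1' : 0 < 1 - ρ J := by linarith
  have hsum : ∑ k ∈ Finset.univ.erase J, ρ k = 1 - ρ J := by
    have h2 := Finset.add_sum_erase _ ρ (Finset.mem_univ J)
    rw [hρ.2] at h2
    linarith
  have hbound := fun z => hξ.expectedLogOdds_posterior_le a hρ h0 h1 z
  have hiN : Integrable (fun z => ∑ k ∈ Finset.univ.erase J, ρ k * (P.q a k z : ℝ)) P.ref :=
    integrable_finsetSum _ fun k _ => (P.integrable_q a k).const_mul _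
  have hiA : Integrable (fun z => (ρ J * P.q a J z -
      ∑ k ∈ Finset.univ.erase J, ρ k * (P.q a k z : ℝ)) * Real.logb 2 (ρ J / (1 - ρ J))) P.ref :=
    (((P.integrable_q a J).const_mul _).sub hiN).mul_const _
  have hiT : ∀ k, Integrable (fun z => ρ k / (1 - ρ J) *
      (ρ J * (P.q a J z * Real.logb 2 (P.q a J z / P.q a k z)) +
        (1 - ρ J) * (P.q a k z * Real.logb 2 (P.q a k z / P.q a J z)))) P.ref := fun k =>
    (((hξ.integrable_q_mul_logb a J k).const_mul _).add
      ((hξ.integrable_q_mul_logb a k J).const_mul _)).const_mul _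
  have hiB := integrable_finsetSum (Finset.univ.erase J) fun k _ => hiT k
  have hint : Integrable (fun z => expectedLogOdds (P.posterior a ρ z J) * P.mix a ρ z) P.ref := by
    refine (hiA.add hiB).mono' ?_ (Filter.Eventually.of_forall fun z => ?_)
    · exact ((measurable_expectedLogOdds.comp ((measurable_pi_apply J).comp
        (P.measurable_posterior a ρ))).mul (P.measurable_mix a ρ)).aestronglyMeasurable
    · rw [Real.norm_of_nonneg (hbound z).1]
      exact (hbound z).2
  refine ⟨hint, (integral_mono hint (hiA.add hiB) fun z => (hbound z).2).trans ?_⟩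
  simp only [Pi.add_apply]
  rw [integral_add hiA hiB, integral_mul_const,
    integral_sub ((P.integrable_q a J).const_mul _) hiN, integral_const_mul, P.integral_q,
    integral_finsetSum _ fun k _ => (P.integrable_q a k).const_mul _,
    integral_finsetSum _ fun k _ => hiT k]
  simp_rw [integral_const_mul, P.integral_q, mul_one]
  rw [hsum]
  have hterm : ∀ k ∈ Finset.univ.erase J, ρ k / (1 - ρ J) * ∫ z,
      (ρ J * (P.q a J z * Real.logb 2 (P.q a J z / P.q a k z)) +
        (1 - ρ J) * (P.q a k z * Real.logb 2 (P.q a k z / P.q a J z))) ∂P.ref ≤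
      ρ k / (1 - ρ J) * P.Dmax.toReal := fun k _ => by
    refine mul_le_mul_of_nonneg_left ?_ (div_nonneg (hρ.1 k) h1'.le)
    rw [integral_add ((hξ.integrable_q_mul_logb a J k).const_mul _)
      ((hξ.integrable_q_mul_logb a k J).const_mul _), integral_const_mul, integral_const_mul]
    have h2 := mul_le_mul_of_nonneg_left (hξ.integral_le_Dmax a J k) h0.le
    have h3 := mul_le_mul_of_nonneg_left (hξ.integral_le_Dmax a k J) h1'.le
    linarith
  refine (add_le_add_right (Finset.sum_le_sum hterm) _).trans (le_of_eq ?_)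
  rw [← Finset.sum_mul, ← Finset.sum_div, hsum, div_self h1'.ne', expectedLogOdds]
  ring

end LogOdds

/-! ### The constant of the combined bound -/

section Constant

/-- The constant in `log₂ u ≤ c * u + logLinConst c`. -/
noncomputable def logLinConst (c : ℝ) : ℝ :=
  max 0 ((-1 - Real.log (c * Real.log 2)) / Real.log 2)

theorem logLinConst_nonneg (c : ℝ) : 0 ≤ logLinConst c := le_max_left _ _

theorem logb_le_linear {c u : ℝ} (hc : 0 < c) (hu : 0 < u) :
    Real.logb 2 u ≤ c * u + logLinConst c := by
  have h2 : 0 < Real.log 2 := Real.log_pos one_lt_two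
  have hc2 : 0 < c * Real.log 2 := mul_pos hc h2
  have h1 := Real.log_le_sub_one_of_pos (mul_pos hu hc2)
  rw [Real.log_mul hu.ne' hc2.ne'] at h1
  have h3 : Real.logb 2 u ≤ c * u + (-1 - Real.log (c * Real.log 2)) / Real.log 2 := by
    rw [Real.logb, div_le_iff₀ h2, add_mul, div_mul_cancel₀ _ h2.ne']
    linarith
  exact h3.trans (by gcongr; exact le_max_right _ _)

theorem logb_penalty_le {c L p : ℝ} (hc : 0 < c) (hL : 1 < L) (hp : 0 < p) (hp2 : p ≤ 1 / 2) :
    Real.logb 2 (L - 1) - Real.logb 2 ((1 - p) / p) ≤ 1 + c * (L * p) + logLinConst c := by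
  have h1 : 0 < 1 - p := by linarith
  have h2 : 0 < L - 1 := by linarith
  have hLp : 0 < L * p := by positivity
  rw [← Real.logb_div h2.ne' (by positivity)]
  have h3 : (L - 1) / ((1 - p) / p) ≤ 2 * (L * p) := by
    rw [div_div_eq_mul_div, div_le_iff₀ h1]
    nlinarith [mul_nonneg hLp.le (sub_nonneg.2 hp2)]
  calc Real.logb 2 ((L - 1) / ((1 - p) / p)) ≤ Real.logb 2 (2 * (L * p)) :=
        Real.logb_le_logb_of_le one_lt_two (by positivity) h3
    _ = 1 + Real.logb 2 (L * p) := by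
        rw [Real.logb_mul two_ne_zero hLp.ne', Real.logb_self_eq_one one_lt_two]
    _ ≤ _ := by linarith [logb_le_linear hc hLp]

/-- The additive constant of the combined bound: it depends only on a common positive lower bound `c`
of `I_max` and `D_max`. -/
noncomputable def additiveConst (c : ℝ) : ℝ := (2 + 2 / Real.log 2 + logLinConst c) / c

theorem additiveConst_nonneg {c : ℝ} (hc : 0 < c) : 0 ≤ additiveConst c := by
  have := logLinConst_nonneg c
  have : 0 < Real.log 2 := Real.log_pos one_lt_two
  unfold additiveConst
  positivity

/-- The log-odds term of the bound, started at belief `p`, is below the cost of stopping when the error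
probability is at least `min p (1 - p)`. -/
theorem logOdds_le_penalty {c L D p ε : ℝ} (hc : 0 < c) (hcD : c ≤ D) (hL : 1 < L) (hp : 0 < p)
    (hp1 : p < 1) (hε : min p (1 - p) ≤ ε) :
    (Real.logb 2 (L - 1) - expectedLogOdds p) / D - additiveConst c ≤ L * ε := by
  wlog hp2 : p ≤ 1 / 2 generalizing p
  · rw [← expectedLogOdds_symm]
    exact this (by linarith) (by linarith) (by rwa [sub_sub_cancel, min_comm]) (by linarith)
  rw [min_eq_left (by linarith)] at hε
  have hD : 0 < D := hc.trans_le hcD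
  have hl2 : 0 < Real.log 2 := Real.log_pos one_lt_two
  have h1 := logb_penalty_le hc hL hp hp2
  have h2 : Real.logb 2 ((1 - p) / p) - 2 / Real.log 2 ≤ expectedLogOdds p := by
    have h3 : p * Real.logb 2 ((1 - p) / p) ≤ 1 / Real.log 2 := by
      have h4 := mul_logb_inv_le hp.le one_pos
      have h5 : Real.logb 2 ((1 - p) / p) ≤ Real.logb 2 (1 / p) :=
        Real.logb_le_logb_of_le one_lt_two (div_pos (by linarith) hp) (by gcongr; linarith)
      have h6 : (1 - p) / Real.log 2 ≤ 1 / Real.log 2 := by gcongr; linarith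
      have h7 := mul_le_mul_of_nonneg_left h5 hp.le
      rw [div_one, Real.logb_one, mul_zero, zero_add] at h4
      linarith
    rw [expectedLogOdds, ← inv_div (1 - p), Real.logb_inv]
    have h8 : 2 / Real.log 2 = 2 * (1 / Real.log 2) := by ring
    linarith
  have hK : c * additiveConst c = 2 + 2 / Real.log 2 + logLinConst c := by
    unfold additiveConst
    field_simp
  have hLp : L * p ≤ L * ε := by gcongr
  rw [sub_le_iff_le_add, div_le_iff₀ hD]
  have h9 : c * (L * p) ≤ D * (L * ε) :=
    mul_le_mul hcD hLp (by positivity) hD.le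
  have h10 : c * additiveConst c ≤ D * additiveConst c :=
    mul_le_mul_of_nonneg_right hcD (additiveConst_nonneg hc)
  linarith

end Constant

/-! ### The combined bound -/

section CombinedBound

variable {M : ℕ} {A : Type u} {Z : Type v} [MeasurableSpace Z]

/-- While all beliefs are at most `1 - δ`, the sum of the entropy term and the log-odds term is below
the cost of stopping. -/
theorem combined_le_penalty (hM : 2 ≤ M) {c L I D δ ξ : ℝ} (hc : 0 < c) (hcI : c ≤ I) (hcD : c ≤ D)
    (hL : 1 < L) (hLI : Real.logb 2 M / I < L) (hδ : 0 < δ) (hδ2 : δ ≤ 1 / 2) (hξ : 0 ≤ ξ)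
    {ρ : Fin M → ℝ} (hρ : ρ ∈ stdSimplex ℝ (Fin M)) (hmax : ∀ i, ρ i ≤ 1 - δ) (j : Fin M) :
    (entropy ρ - (entropy ![δ, 1 - δ] + δ * Real.logb 2 ((M : ℝ) - 1))) / I +
      ((Real.logb 2 (L - 1) - Real.logb 2 ((1 - δ) / δ) - ξ) / D - additiveConst c) ≤
        L * (1 - ρ j) := by
  have hI : 0 < I := hc.trans_le hcI
  have hD : 0 < D := hc.trans_le hcD
  have hM' : (2 : ℝ) ≤ M := by exact_mod_cast hM
  have hlg : Real.logb 2 ((M : ℝ) - 1) ≤ L * I := by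
    rw [div_lt_iff₀ hI] at hLI
    exact (Real.logb_le_logb_of_le one_lt_two (by linarith) (by linarith)).trans hLI.le
  have hH : entropy ρ ≤ 1 + (1 - ρ j) * Real.logb 2 ((M : ℝ) - 1) := by
    have h1 := entropy_le_tangent hM hρ j (r := 1 / 2) (by norm_num) (by norm_num)
    have h2 : entropy ![(1 / 2 : ℝ), 1 - 1 / 2] = 1 := by
      rw [entropy_pair]
      norm_num
    have h3 : Real.logb 2 ((1 - 1 / 2) / (1 / 2)) = 0 := by norm_num
    rw [h2, h3] at h1
    linarith
  have hδH : 0 ≤ entropy ![δ, 1 - δ] := by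
    rw [entropy_pair]
    exact add_nonneg (mul_logb_inv_nonneg hδ.le (by linarith))
      (mul_logb_inv_nonneg (by linarith) (by linarith))
  have hε : 0 ≤ 1 - ρ j - δ := by linarith [hmax j]
  have h1 : (entropy ρ - (entropy ![δ, 1 - δ] + δ * Real.logb 2 ((M : ℝ) - 1))) / I ≤
      1 / c + (1 - ρ j - δ) * L := by
    rw [div_le_iff₀ hI, add_mul]
    have h2 := mul_le_mul_of_nonneg_left hlg hε
    have h3 : 1 ≤ 1 / c * I := by
      rw [one_div_mul_eq_div]
      exact (one_le_div hc).2 hcI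
    linarith
  have hκ := logLinConst_nonneg c
  have h2 : (Real.logb 2 (L - 1) - Real.logb 2 ((1 - δ) / δ) - ξ) / D ≤
      L * δ + (1 + logLinConst c) / c := by
    rw [div_le_iff₀ hD, add_mul]
    have h3 := logb_penalty_le hc hL hδ hδ2
    have h4 : c * (L * δ) ≤ L * δ * D := by
      rw [mul_comm]
      exact mul_le_mul_of_nonneg_left hcD (by positivity)
    have h5 : 1 + logLinConst c ≤ (1 + logLinConst c) / c * D := by
      rw [div_mul_eq_mul_div, le_div_iff₀ hc]
      exact mul_le_mul_of_nonneg_left hcD (by positivity)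
    linarith
  have h3 : 1 / c + (1 + logLinConst c) / c ≤ additiveConst c := by
    have hl2 : 0 < Real.log 2 := Real.log_pos one_lt_two
    have : (0 : ℝ) ≤ 2 / Real.log 2 := by positivity
    rw [← add_div]
    exact div_le_div_of_nonneg_right (by linarith) hc.le
  linarith

/-- One observation raises the log-odds of a hypothesis by at most `ξ`, so a belief that passes the
level `1 - δ` overshoots it by at most `ξ` on the scale of log-odds. -/
theorem ObsModel.BoundedLLR.overshoot_le {P : ObsModel (Fin M) A Z} {ξ : ℝ} (hξ : P.BoundedLLR ξ)
    (a : A) {ρ : Fin M → ℝ} (hρ : ρ ∈ stdSimplex ℝ (Fin M)) {δ : ℝ} (hδ : 0 < δ) (hδ2 : δ ≤ 1 / 2)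
    {J : Fin M} (hJ : ρ J ≤ 1 - δ) {z : Z} (hz : P.mix a ρ z ≠ 0)
    (hx : 1 - δ < P.posterior a ρ z J) :
    P.posterior a ρ z J < 1 ∧
      expectedLogOdds (P.posterior a ρ z J) ≤ Real.logb 2 ((1 - δ) / δ) + ξ := by
  have hm : 0 < P.mix a ρ z := (P.mix_nonneg a hρ z).lt_of_ne' hz
  have hbayes := P.posterior_mul_mix a hρ z J
  set x := P.posterior a ρ z J
  set f : ℝ := (P.q a J z : ℝ) with hf
  have hf0 : 0 ≤ f := NNReal.coe_nonneg _
  have h2ξ : 0 < (2 : ℝ) ^ ξ := by positivity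
  have hrest : (1 - ρ J) * f ≤ 2 ^ ξ * ((1 - x) * P.mix a ρ z) := by
    have h1 : ρ J * (2 ^ ξ * f - f) ≤ ∑ k, ρ k * (2 ^ ξ * P.q a k z - f) :=
      Finset.single_le_sum (f := fun k => ρ k * (2 ^ ξ * (P.q a k z : ℝ) - f))
        (fun k _ => mul_nonneg (hρ.1 k) (sub_nonneg.2 (hξ.q_le a J k z))) (Finset.mem_univ J)
    have h2 : ∑ k, ρ k * (2 ^ ξ * P.q a k z - f) = 2 ^ ξ * P.mix a ρ z - f := by
      have h3 : ∀ k, ρ k * (2 ^ ξ * P.q a k z - f) = 2 ^ ξ * (ρ k * P.q a k z) - ρ k * f :=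
        fun k => by ring
      simp_rw [h3]
      rw [Finset.sum_sub_distrib, ← Finset.mul_sum, ← Finset.sum_mul, hρ.2, one_mul]
      rfl
    rw [h2] at h1
    linear_combination h1 + 2 ^ ξ * hbayes
  have hx0 : 0 < x := by linarith
  have hkey : x * δ ≤ (1 - δ) * 2 ^ ξ * (1 - x) := by
    refine le_of_mul_le_mul_right ?_ hm
    calc x * δ * P.mix a ρ z = ρ J * (f * δ) := by linear_combination δ * hbayes
      _ ≤ (1 - δ) * (f * (1 - ρ J)) := by
        refine mul_le_mul hJ ?_ (by positivity) (by linarith)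
        exact mul_le_mul_of_nonneg_left (by linarith) hf0
      _ ≤ (1 - δ) * (2 ^ ξ * ((1 - x) * P.mix a ρ z)) := by
        refine mul_le_mul_of_nonneg_left ?_ (by linarith)
        linarith
      _ = _ := by ring
  have hx1 : x < 1 := by
    by_contra! h
    have h1 : 0 < x * δ := by positivity
    have h2 : (1 - δ) * 2 ^ ξ * (1 - x) ≤ 0 :=
      mul_nonpos_of_nonneg_of_nonpos (mul_nonneg (by linarith) h2ξ.le) (by linarith)
    linarith
  refine ⟨hx1, ?_⟩
  have hodds := logb_odds_nonneg (by linarith) hx1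
  have h1x : 0 < 1 - x := by linarith
  have h1δ : 0 < (1 - δ) / δ := div_pos (by linarith) hδ
  calc expectedLogOdds x ≤ Real.logb 2 (x / (1 - x)) :=
        mul_le_of_le_one_left hodds (by linarith)
    _ ≤ Real.logb 2 ((1 - δ) / δ * 2 ^ ξ) := by
        refine Real.logb_le_logb_of_le one_lt_two (by positivity) ?_
        rw [div_mul_eq_mul_div, div_le_div_iff₀ h1x hδ]
        exact hkey
    _ = Real.logb 2 ((1 - δ) / δ) + ξ := by
        rw [Real.logb_mul h1δ.ne' h2ξ.ne', Real.logb_rpow (by norm_num) (by norm_num)]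

/-- The entropy is below its Fano bound at error probability `δ` once a belief exceeds `1 - δ`. -/
theorem entropy_le_of_lt (hM : 2 ≤ M) {δ : ℝ} (hδ : 0 < δ) (hδ2 : δ ≤ 1 / 2) {ρ : Fin M → ℝ}
    (hρ : ρ ∈ stdSimplex ℝ (Fin M)) {J : Fin M} (hJ : 1 - δ < ρ J) :
    entropy ρ ≤ entropy ![δ, 1 - δ] + δ * Real.logb 2 ((M : ℝ) - 1) := by
  have hM' : (2 : ℝ) ≤ M := by exact_mod_cast hM
  have h1 := entropy_le_tangent hM hρ J hδ (by linarith)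
  have h2 : 0 ≤ Real.logb 2 ((1 - δ) / δ) :=
    Real.logb_nonneg one_lt_two ((one_le_div hδ).2 (by linarith))
  have h3 : 0 ≤ Real.logb 2 ((M : ℝ) - 1) := Real.logb_nonneg one_lt_two (by linarith)
  have h4 := mul_nonpos_of_nonpos_of_nonneg (by linarith : 1 - ρ J - δ ≤ 0) (add_nonneg h2 h3)
  linarith

theorem ObsModel.BoundedLLR.posterior_pos {P : ObsModel (Fin M) A Z} {ξ : ℝ}
    (hξ : P.BoundedLLR ξ) (a : A) {ρ : Fin M → ℝ} (hρ : ρ ∈ stdSimplex ℝ (Fin M)) {z : Z}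
    (hz : P.mix a ρ z ≠ 0) {k : Fin M} (hk : 0 < ρ k) : 0 < P.posterior a ρ z k := by
  obtain ⟨i, -, hi⟩ := Finset.exists_ne_zero_of_sum_ne_zero hz
  have hqi : 0 < P.q a i z := pos_iff_ne_zero.2 fun h => hi (by rw [h, NNReal.coe_zero, mul_zero])
  have hqk : (0 : ℝ) < P.q a k z := hξ.q_pos k hqi
  have hb := P.posterior_mul_mix a hρ z k
  exact pos_of_mul_pos_left (hb ▸ mul_pos hk hqk) (P.mix_nonneg a hρ z)

theorem ObsModel.BoundedLLR.posterior_lt_one {P : ObsModel (Fin M) A Z} {ξ : ℝ}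
    (hξ : P.BoundedLLR ξ) (a : A) {ρ : Fin M → ℝ} (hρ : ρ ∈ stdSimplex ℝ (Fin M)) {z : Z}
    (hz : P.mix a ρ z ≠ 0) {J : Fin M} (hJ : ρ J < 1) : P.posterior a ρ z J < 1 := by
  obtain ⟨k, hk, hk0⟩ : ∃ k ∈ Finset.univ.erase J, ρ k ≠ 0 := by
    refine Finset.exists_ne_zero_of_sum_ne_zero fun h0 => hJ.ne ?_
    have h := Finset.add_sum_erase _ ρ (Finset.mem_univ J)
    rw [hρ.2, h0, add_zero] at h
    exact h
  have h1 := hξ.posterior_pos a hρ hz ((hρ.1 k).lt_of_ne' hk0)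
  have h2 := add_le_one_of_mem_stdSimplex (P.posterior_mem a hρ z) (Finset.ne_of_mem_erase hk)
  linarith

theorem ObsModel.BoundedLLR.logOdds_bellman {P : ObsModel (Fin M) A Z} {ξ : ℝ}
    (hξ : P.BoundedLLR ξ) (hD : 0 < P.Dmax.toReal) (a : A) {ρ : Fin M → ℝ}
    (hρ : ρ ∈ stdSimplex ℝ (Fin M)) {J : Fin M} (h0 : 0 < ρ J) (h1 : ρ J < 1) (b c : ℝ) :
    (b - expectedLogOdds (ρ J)) / P.Dmax.toReal - c ≤
      1 + P.T a (fun ρ => (b - expectedLogOdds (ρ J)) / P.Dmax.toReal - c) ρ := by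
  obtain ⟨hint, hle⟩ := hξ.T_expectedLogOdds_le a hρ h0 h1
  have hT : P.T a (fun ρ => (b - expectedLogOdds (ρ J)) / P.Dmax.toReal - c) ρ =
      (b - ∫ z, expectedLogOdds (P.posterior a ρ z J) * P.mix a ρ z ∂P.ref) /
        P.Dmax.toReal - c := by
    have h2 : ∀ z, ((b - expectedLogOdds (P.posterior a ρ z J)) / P.Dmax.toReal - c) *
        P.mix a ρ z = (b / P.Dmax.toReal - c) * P.mix a ρ z -
          P.Dmax.toReal⁻¹ * (expectedLogOdds (P.posterior a ρ z J) * P.mix a ρ z) := fun z => by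
      ring
    unfold ObsModel.T
    simp_rw [h2]
    rw [integral_sub ((P.integrable_mix a ρ).const_mul _) (hint.const_mul _), integral_const_mul,
      integral_const_mul, P.integral_mix a hρ]
    ring
  rw [hT]
  have h3 : (b - expectedLogOdds (ρ J)) / P.Dmax.toReal ≤
      1 + (b - ∫ z, expectedLogOdds (P.posterior a ρ z J) * P.mix a ρ z ∂P.ref) /
        P.Dmax.toReal := by
    rw [div_le_iff₀ hD, add_mul, div_mul_cancel₀ _ hD.ne']
    linarith
  linarith

open Classical in
/-- The lower bound for the value function that the verification argument is applied to: the larger of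
the log-odds bounds of the single hypotheses and, while no belief exceeds `1 - δ`, the entropy term plus
the log-odds that are still to be gained after the level `1 - δ` has been passed. A hypothesis that is
certain or excluded contributes `0`, since `expectedLogOdds` has a junk value there. -/
noncomputable def combinedBound (P : ObsModel (Fin M) A Z) (ξ K L δ : ℝ) (ρ : Fin M → ℝ) : ℝ≥0∞ :=
  (if ∀ i, ρ i ≤ 1 - δ then
    ENNReal.ofReal ((entropy ρ - (entropy ![δ, 1 - δ] + δ * Real.logb 2 ((M : ℝ) - 1))) / P.Imax +
      ((Real.logb 2 (L - 1) - Real.logb 2 ((1 - δ) / δ) - ξ) / P.Dmax.toReal - K)) else 0) ⊔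
  ⨆ J, if 0 < ρ J ∧ ρ J < 1 then
    ENNReal.ofReal ((Real.logb 2 (L - 1) - expectedLogOdds (ρ J)) / P.Dmax.toReal - K) else 0

theorem measurable_combinedBound (P : ObsModel (Fin M) A Z) (ξ K L δ : ℝ) :
    Measurable (combinedBound P ξ K L δ) := by
  classical
  refine Measurable.sup (Measurable.ite ?_ ?_ measurable_const)
    (Measurable.iSup fun J => Measurable.ite ?_ ?_ measurable_const)
  · rw [Set.ofPred_forall]
    exact MeasurableSet.iInter fun i => measurableSet_le (measurable_pi_apply i) measurable_const
  · exact ((((measurable_entropy M).sub_const _).div_const _).add_const _).ennreal_ofReal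
  · exact (measurableSet_lt measurable_const (measurable_pi_apply J)).inter
      (measurableSet_lt (measurable_pi_apply J) measurable_const)
  · exact (((measurable_const.sub (measurable_expectedLogOdds.comp
      (measurable_pi_apply J))).div_const _).sub_const _).ennreal_ofReal

theorem combinedBound_le_Vstar [Finite A] [MeasurableSpace A] [MeasurableSingletonClass A]
    (P : ObsModel (Fin M) A Z) {ξ c L δ : ℝ} (hξ : P.BoundedLLR ξ) (hξ0 : 0 ≤ ξ) (hM : 2 ≤ M)
    (hc : 0 < c) (hcI : c ≤ P.Imax) (hcD : c ≤ P.Dmax.toReal) (hL : 1 < L)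
    (hLI : Real.logb 2 M / P.Imax < L) (hδ : 0 < δ) (hδ2 : δ ≤ 1 / 2) {ρ : Fin M → ℝ}
    (hρ : ρ ∈ stdSimplex ℝ (Fin M)) :
    combinedBound P ξ (additiveConst c) L δ ρ ≤ Vstar P L ρ := by
  have hI : 0 < P.Imax := hc.trans_le hcI
  have hD : 0 < P.Dmax.toReal := hc.trans_le hcD
  refine le_Vstar_of_bellman P (by linarith) (measurable_combinedBound P _ _ _ _) ?_ ?_ hρ
  · intro ρ hρ j
    refine sup_le ?_ (iSup_le fun J => ?_)
    · split_ifs with hmax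
      · exact ENNReal.ofReal_le_ofReal
          (combined_le_penalty hM hc hcI hcD hL hLI hδ hδ2 hξ0 hρ hmax j)
      · exact zero_le
    · split_ifs with hJ
      · refine ENNReal.ofReal_le_ofReal (logOdds_le_penalty hc hcD hL hJ.1 hJ.2 ?_)
        rcases eq_or_ne J j with rfl | hne
        · exact min_le_right _ _
        · exact (min_le_left _ _).trans (by linarith [add_le_one_of_mem_stdSimplex hρ hne])
      · exact zero_le
  · intro ρ hρ a
    refine sup_le ?_ (iSup_le fun J => ?_)
    · split_ifs with hmax
      · refine P.bellman_of_integral a hρ (f := fun ρ => (entropy ρ - (entropy ![δ, 1 - δ] +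
            δ * Real.logb 2 ((M : ℝ) - 1))) / P.Imax + ((Real.logb 2 (L - 1) -
            Real.logb 2 ((1 - δ) / δ) - ξ) / P.Dmax.toReal - additiveConst c))
          (P.entropy_bellman hI a hρ _ _) fun z hz => ?_
        by_cases hpost : ∀ i, P.posterior a ρ z i ≤ 1 - δ
        · refine le_sup_of_le_left ?_
          rw [if_pos hpost]
        · -- the level `1 - δ` has just been passed: the entropy term is spent, and the log-odds
          -- bound of the leading hypothesis takes over
          push Not at hpost
          obtain ⟨J, hJ⟩ := hpost
          obtain ⟨hlt, hover⟩ := hξ.overshoot_le a hρ hδ hδ2 (hmax J) hz hJ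
          refine le_sup_of_le_right (le_iSup_of_le J ?_)
          rw [if_pos ⟨by linarith, hlt⟩]
          refine ENNReal.ofReal_le_ofReal ?_
          have h1 : (entropy (P.posterior a ρ z) - (entropy ![δ, 1 - δ] +
              δ * Real.logb 2 ((M : ℝ) - 1))) / P.Imax ≤ 0 :=
            div_nonpos_of_nonpos_of_nonneg
              (sub_nonpos.2 (entropy_le_of_lt hM hδ hδ2 (P.posterior_mem a hρ z) hJ)) hI.le
          have h2 : (Real.logb 2 (L - 1) - Real.logb 2 ((1 - δ) / δ) - ξ) / P.Dmax.toReal ≤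
              (Real.logb 2 (L - 1) - expectedLogOdds (P.posterior a ρ z J)) / P.Dmax.toReal :=
            div_le_div_of_nonneg_right (by linarith) hD.le
          linarith
      · exact zero_le
    · split_ifs with hJ
      · refine P.bellman_of_integral a hρ (f := fun ρ => (Real.logb 2 (L - 1) -
            expectedLogOdds (ρ J)) / P.Dmax.toReal - additiveConst c)
          (hξ.logOdds_bellman hD a hρ hJ.1 hJ.2 _ _) fun z hz => ?_
        refine le_sup_of_le_right (le_iSup_of_le J ?_)
        rw [if_pos ⟨hξ.posterior_pos a hρ hz hJ.1, hξ.posterior_lt_one a hρ hz hJ.2⟩]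
      · exact zero_le

theorem V2_le_Vstar [Finite A] [MeasurableSpace A] [MeasurableSingletonClass A]
    (P : ObsModel (Fin M) A Z) {ξ c L δ : ℝ} (hξ : P.BoundedLLR ξ)
    (hc : 0 < c) (hcI : c ≤ P.Imax) (hcD : c ≤ P.Dmax.toReal)
    (hL : max 1 (Real.logb 2 M / P.Imax) < L) (hδ : 0 < δ) (hδ2 : δ ≤ 1 / 2) {ρ : Fin M → ℝ}
    (hρ : ρ ∈ region M L) :
    ENNReal.ofReal (V2 P ξ (additiveConst c) L δ ρ) ≤ Vstar P L ρ := by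
  have hM := two_le_of_mem_region hρ
  have hI : 0 < P.Imax := hc.trans_le hcI
  obtain ⟨hL1, hLI⟩ := max_lt_iff.1 hL
  have hξ0 : 0 ≤ ξ := by
    rcases isEmpty_or_nonempty A with hA | ⟨⟨a⟩⟩
    · simp [ObsModel.Imax, Real.iSup_of_isEmpty] at hI
    · exact hξ.nonneg a ⟨0, by omega⟩
  have hodds : (1 - L⁻¹) / L⁻¹ = L - 1 := by
    have : L ≠ 0 := by linarith
    field_simp
  unfold V2
  rw [hodds, ENNReal.ofReal_max, ENNReal.ofReal_zero]
  refine max_le zero_le ?_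
  split_ifs with hmax
  · refine le_trans ?_ (combinedBound_le_Vstar P hξ hξ0 hM hc hcI hcD hL1 hLI hδ hδ2 hρ.1)
    refine le_sup_of_le_left ?_
    rw [if_pos hmax, mul_one, sub_sub, add_sub_assoc]
  · push Not at hmax
    obtain ⟨J, hJ⟩ := hmax
    rw [ENNReal.ofReal_of_nonpos]
    · exact zero_le
    · have h1 := div_nonpos_of_nonpos_of_nonneg
        (sub_nonpos.2 (entropy_le_of_lt hM hδ hδ2 hρ.1 hJ)) hI.le
      have h2 := additiveConst_nonneg hc
      rw [← sub_sub] at h1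
      linarith

theorem ObsModel.Dmax_toReal_pos {P : ObsModel (Fin M) A Z} {ξ : ℝ} (hM : 2 ≤ M)
    (hP : P.Distinguishable) (hξ : P.BoundedLLR ξ) : 0 < P.Dmax.toReal := by
  obtain ⟨a, ha⟩ := hP ⟨0, by omega⟩ ⟨1, by omega⟩ (by simp)
  have hle : P.D a ⟨0, by omega⟩ ⟨1, by omega⟩ ≤ P.Dmax :=
    le_iSup_of_le _ (le_iSup_of_le _ (le_iSup (fun a => P.D a _ _) a))
  exact ENNReal.toReal_pos (ha.trans_le hle).ne' hξ.Dmax_ne_top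

end CombinedBound

/-! ### Growing sequences of problems -/

section Growing

/-- A belief on the first `m` hypotheses, extended by zero. -/
noncomputable def extendBelief {m n : ℕ} (ρ : Fin m → ℝ) : Fin n → ℝ :=
  fun i => if h : i.1 < m then ρ ⟨i, h⟩ else 0

theorem sum_extend {m n : ℕ} (hmn : m ≤ n) (g : Fin m → ℝ) :
    ∑ i : Fin n, (if h : i.1 < m then g ⟨i, h⟩ else 0) = ∑ i, g i := by
  obtain ⟨k, rfl⟩ := Nat.exists_eq_add_of_le hmn
  simp [Fin.sum_univ_add]

theorem extendBelief_mem {m n : ℕ} (hmn : m ≤ n) {ρ : Fin m → ℝ}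
    (hρ : ρ ∈ stdSimplex ℝ (Fin m)) : (extendBelief ρ : Fin n → ℝ) ∈ stdSimplex ℝ (Fin n) := by
  refine ⟨fun i => ?_, ?_⟩
  · unfold extendBelief
    split_ifs
    exacts [hρ.1 _, le_rfl]
  · exact (sum_extend hmn ρ).trans hρ.2

theorem entropy_extendBelief {m n : ℕ} (hmn : m ≤ n) (ρ : Fin m → ℝ) :
    entropy (extendBelief ρ : Fin n → ℝ) = entropy ρ := by
  unfold entropy
  rw [← sum_extend hmn]
  refine Finset.sum_congr rfl fun i _ => ?_
  unfold extendBelief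
  split_ifs <;> simp

variable {B : Type u} {Z : Type v} [MeasurableSpace Z]

theorem mutualInfo_restrict_extendBelief (Q : ObsModel ℕ B Z) {m n : ℕ} (hmn : m ≤ n)
    {s t : Finset B} (hst : s ⊆ t) (a : {a // a ∈ s}) (ρ : Fin m → ℝ) :
    (Q.restrict n t).mutualInfo ⟨a, hst a.2⟩ (extendBelief ρ) =
      (Q.restrict m s).mutualInfo a ρ := by
  have hmix : ∀ z, (Q.restrict n t).mix ⟨a, hst a.2⟩ (extendBelief ρ) z =
      (Q.restrict m s).mix a ρ z := fun z => by
    unfold ObsModel.mix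
    rw [← sum_extend hmn]
    refine Finset.sum_congr rfl fun i _ => ?_
    unfold extendBelief
    split_ifs
    · rfl
    · simp
  have hpost : ∀ z, (Q.restrict n t).posterior ⟨a, hst a.2⟩ (extendBelief ρ) z =
      extendBelief ((Q.restrict m s).posterior a ρ z) := fun z => by
    unfold ObsModel.posterior
    rw [hmix]
    split_ifs
    · rfl
    · funext i
      unfold extendBelief
      split_ifs
      · rfl
      · simp
  unfold ObsModel.mutualInfo ObsModel.T
  simp_rw [hpost, hmix, entropy_extendBelief hmn]
  rfl

theorem Imax_restrict_mono (Q : ObsModel ℕ B Z) {m n : ℕ} (hm : 0 < m) (hmn : m ≤ n)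
    {s t : Finset B} (hs : s.Nonempty) (hst : s ⊆ t) :
    (Q.restrict m s).Imax ≤ (Q.restrict n t).Imax := by
  have : Nonempty {a // a ∈ s} := hs.to_subtype
  have : Nonempty (stdSimplex ℝ (Fin m)) :=
    ⟨⟨Pi.single ⟨0, hm⟩ 1, single_mem_stdSimplex ℝ _⟩⟩
  refine ciSup_le fun p => ?_
  rw [← mutualInfo_restrict_extendBelief Q hmn hst]
  exact (Q.restrict n t).mutualInfo_le_Imax _ (extendBelief_mem hmn p.2.2)

theorem Dmax_restrict_mono (Q : ObsModel ℕ B Z) {m n : ℕ} (hmn : m ≤ n)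
    {s t : Finset B} (hst : s ⊆ t) : (Q.restrict m s).Dmax ≤ (Q.restrict n t).Dmax :=
  iSup_le fun i => iSup_le fun j => iSup_le fun a =>
    le_iSup_of_le (Fin.castLE hmn i) (le_iSup_of_le (Fin.castLE hmn j)
      (le_iSup_of_le ⟨a, hst a.2⟩ le_rfl))

end Growing

end ActiveTesting

theorem theorem2 {M : ℕ} {A : Type u} {Z : Type v} [Finite A] [MeasurableSpace A]
    [MeasurableSingletonClass A] [MeasurableSpace Z] (P : ObsModel (Fin M) A Z) :
    -- the entropy bound
    (P.Distinguishable → ∀ L : ℝ, 1 < L → ∀ ρ ∈ region M L,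
      ENNReal.ofReal (max 0
        ((entropy ρ - entropy ![P.alpha L, 1 - P.alpha L]
            - P.alpha L * Real.logb 2 ((M : ℝ) - 1)) / P.Imax + P.alpha L * L))
        ≤ Vstar P L ρ) ∧
    -- the combined bound, with a constant `K` that depends neither on `L` nor on `δ` (nor on `ρ`)
    (P.Distinguishable → ∀ ξ : ℝ, P.BoundedLLR ξ →
      ∃ K : ℝ, ∀ L : ℝ, max 1 (Real.logb 2 (M : ℝ) / P.Imax) < L →
        ∀ δ : ℝ, 0 < δ → δ ≤ 1 / 2 → ∀ ρ ∈ region M L,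
          ENNReal.ofReal (V2 P ξ K L δ ρ) ≤ Vstar P L ρ) ∧
    -- in a growing sequence of problems with uniformly bounded `ξ m`, `K` does not depend on the
    -- number `m` of hypotheses either
    (∀ (B : Type u) [MeasurableSpace B] [MeasurableSingletonClass B] (Q : ObsModel ℕ B Z)
      (S : ℕ → Finset B) (ξ : ℕ → ℝ), Monotone S → BddAbove (ξ '' Set.Ici 2) →
      (∀ m : ℕ, 2 ≤ m → (Q.restrict m (S m)).Distinguishable ∧
        (Q.restrict m (S m)).BoundedLLR (ξ m)) →
      ∃ K : ℝ, ∀ m : ℕ, 2 ≤ m → ∀ L : ℝ,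
        max 1 (Real.logb 2 (m : ℝ) / (Q.restrict m (S m)).Imax) < L →
        ∀ δ : ℝ, 0 < δ → δ ≤ 1 / 2 → ∀ ρ ∈ region m L,
          ENNReal.ofReal (V2 (Q.restrict m (S m)) (ξ m) K L δ ρ)
            ≤ Vstar (Q.restrict m (S m)) L ρ) := by
  refine ⟨fun hP L hL ρ hρ => ?_, fun hP ξ hξ => ?_, fun B _ _ Q S ξ hS _ hQ => ?_⟩
  · rw [ENNReal.ofReal_max, ENNReal.ofReal_zero]
    exact max_le zero_le (entropy_bound_le_Vstar P hP hL hρ)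
  · -- for `M < 2` the region is empty, and the constant does not matter
    by_cases hM : 2 ≤ M
    · have hI := P.Imax_pos hM hP
      have hD := ObsModel.Dmax_toReal_pos hM hP hξ
      exact ⟨additiveConst (min P.Imax P.Dmax.toReal), fun L hL δ hδ hδ2 ρ hρ =>
        V2_le_Vstar P hξ (lt_min hI hD) (min_le_left _ _) (min_le_right _ _) hL hδ hδ2 hρ⟩
    · exact ⟨0, fun L _ δ _ _ ρ hρ => absurd (two_le_of_mem_region hρ) hM⟩
  · -- `I_max` and `D_max` are nondecreasing along the sequence, so the values at `m = 2` are
    -- common lower bounds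
    obtain ⟨hP2, hξ2⟩ := hQ 2 le_rfl
    have hI := (Q.restrict 2 (S 2)).Imax_pos le_rfl hP2
    have hD := ObsModel.Dmax_toReal_pos le_rfl hP2 hξ2
    obtain ⟨a, -⟩ := hP2 0 1 (by simp)
    refine ⟨additiveConst (min (Q.restrict 2 (S 2)).Imax (Q.restrict 2 (S 2)).Dmax.toReal),
      fun m hm L hL δ hδ hδ2 ρ hρ =>
        V2_le_Vstar _ (hQ m hm).2 (lt_min hI hD) ((min_le_left _ _).trans ?_)
          ((min_le_right _ _).trans ?_) hL hδ hδ2 hρ⟩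
    · exact Imax_restrict_mono Q two_pos hm ⟨a, a.2⟩ (hS hm)
    · exact ENNReal.toReal_mono (hQ m hm).2.Dmax_ne_top (Dmax_restrict_mono Q hm (hS hm))
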